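/- **Setting.** Fix a countably infinite set $\mathcal C$ of values (effectively presented, say $\mathcal C=\mathbb N$). A *data-centric dynamic system* (DCDS) $\mathcal S$ consists of * a finite relational schema $\mathcal R$; an initial database instance $I_0$ (a finite set of facts over $\mathcal R$ with values in $\mathcal C$); and a finite set $\mathcal E$ of equality constraints $Q\to\bigwedge_j z_j=y_j$, where $Q$ is a first-order (FO) query over $\mathcal R$ and each $z_j,y_j$ is a free variable of $Q$ or a constant; $I_0$ satisfies $\mathcal E$; * a finite set of service symbols $f$ with arities; a finite set of actions $\alpha(p_1,\dots,p_m)$ with distinct parameters, each having finitely many effects $q^+\wedge Q^-\rightsquigarrow E$, where $q^+$ is a union of conjunctive queries, $Q^-$ is an FO query whose free variables are free variables of $q^+$ or parameters of $\alpha$, and $E$ is a finite set of facts over $\mathcal R$ whose terms are constants, parameters, free variables of $q^+$, or service calls $f(\vec t)$ applied to such terms; and a finite set of condition-action rules $Q\mapsto\alpha$, where $Q$ is an FO query whose free variables are exactly the parameters of $\alpha$. All constants in the specification belong to $\mathrm{adom}(I_0)$, where $\mathrm{adom}(I)$ is the set of values that occur in $I$. Queries over an instance $I$ have the active-domain semantics: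 answers and quantified variables range over $\mathrm{adom}(I)\cup\mathrm{adom}(I_0)$, and constants denote themselves. *Semantics with nondeterministic services.* Given an instance $I$, a rule $Q\mapsto\alpha$ and an answer $\sigma$ to $Q$ over $I$, let $\mathrm{DO}(I,\alpha,\sigma)$ be the union of the sets $E\sigma\theta'$ over all effects $q^+\wedge Q^-\rightsquigarrow E$ of $\alpha$ and all answers $\theta'$ to $(q^+\wedge Q^-)\sigma$ over $I$. Let $\theta$ assign an arbitrary value in $\mathcal C$ to each ground service call in $\mathrm{DO}(I,\alpha,\sigma)$. If $I'=\mathrm{DO}(I,\alpha,\sigma)\theta$ satisfies $\mathcal E$, then $I\Rightarrow I'$. The *concrete transition system* $\Upsilon_{\mathcal S}$ has as states the instances reachable from the initial state $I_0$ by $\Rightarrow$. The DCDS $\mathcal S$ is *state-bounded* if there is a number $b$ with $|\mathrm{adom}(I)|<b$ for every state $I$ of $\Upsilon_{\mathcal S}$. *The logic $\mu\mathcal L_P$.* Formulae are $$\Phi ::= Q \mid \neg\Phi \mid \Phi_1\wedge\Phi_2 \mid \exists x.\,\mathrm{LIVE}(x)\wedge\Phi \mid \langle-\rangle(\mathrm{LIVE}(\vec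 x)\wedge\Phi) \mid [-](\mathrm{LIVE}(\vec x)\wedge\Phi) \mid Z \mid \mu Z.\Phi ,$$ where $Q$ is a possibly open FO query over $\mathcal R$ with constants in $\mathrm{adom}(I_0)$, and $\mathrm{LIVE}(x)$ says that the value of $x$ is in the active domain of the current state. In the modal formulae $\vec x$ lists exactly the free individual variables of $\Phi$, once each bound predicate variable is replaced (without variable capture) by the fixpoint formula that binds it. In $\mu Z.\Phi$ every free occurrence of $Z$ in $\Phi$ is under an even number of negations. $\langle-\rangle$ means "in some successor", $[-]$ means "in all successors", and $\mu$ is the least fixpoint. A closed formula holds in a transition system if it holds in its initial state. *Persistence-preserving bisimilarity.* Let $\Upsilon_1,\Upsilon_2$ be transition systems whose states are labelled by databases. A set $B$ of triples $(s_1,h,s_2)$ is a persistence-preserving bisimulation if for every $(s_1,h,s_2)\in B$: $h$ is a bijection inducing an isomorphism from the database of $s_1$ to that of $s_2$ and fixing the constants in $\mathrm{adom}(I_0)$; for every $s_1\Rightarrow s_1'$ there are $s_2\Rightarrow s_2'$ and $(s_1',h',s_2')\in B$, and symmetrically for every $s_2\Rightarrow s_2'$ there are $s_1\Rightarrow s_1'$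 and $(s_1',h',s_2')\in B$, such that $h$ and $h'$ agree on the values that occur in both $s_1$ and $s_1'$, and $h^{-1}$ and $h'^{-1}$ agree on the values that occur in both $s_2$ and $s_2'$. The systems are bisimilar if some such $B$ relates their initial states. **Theorem.** Verification of $\mu\mathcal L_P$ properties of state-bounded DCDSs with nondeterministic services is decidable: there is an algorithm which, given a state-bounded DCDS $\mathcal S$ and a closed $\mu\mathcal L_P$ formula $\Phi$ over it (but no bound on the states), terminates and decides whether $\Upsilon_{\mathcal S}\models\Phi$. Moreover, for every state-bounded DCDS $\mathcal S$ there is a finite-state transition system whose initial state is that of $\Upsilon_{\mathcal S}$ and whose states and transitions are among those of $\Upsilon_{\mathcal S}$, which is persistence-preserving bisimilar to $\Upsilon_{\mathcal S}$ and satisfies the same closed $\mu\mathcal L_P$ formulae. -/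

import Mathlib

/-! Relational data-centric dynamic systems (DCDSs) with nondeterministic services, the first-order
mu-calculus with persistent quantification, and persistence-preserving bisimulation.

The countably infinite set of constants/values is `ℕ`. Relation symbols, service symbols, actions,
individual variables and predicate variables are named by natural numbers. -/

namespace DCDS

/-! ### First-order queries -/

/-- Terms of queries: individual variables and constants. -/
inductive Term
  | var (x : ℕ)
  | const (c : ℕ)
  deriving DecidableEq

/-- First-order formulae over relational atoms and equalities. -/
inductive FO
  | tru
  | atom (R : ℕ) (ts : List Term)
  | eq (t u : Term)
  | neg (φ : FO)
  | and (φ ψ : FO)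
  | or (φ ψ : FO)
  | ex (x : ℕ) (φ : FO)

/-- A fact `R(c₁, …, cₙ)` over the values `ℕ`. -/
abbrev Fact := ℕ × List ℕ

/-- A database instance: a finite set of facts. -/
abbrev Inst := Finset Fact

/-- The active domain: the values that occur in the instance. -/
def adom (I : Inst) : Finset ℕ := I.biUnion fun F => F.2.toFinset

/-- `F` conforms to a schema, given by the list of the arities of the relation symbols
`0, 1, …`. -/
def Conforms (schema : List ℕ) (F : Fact) : Prop := schema[F.1]? = some F.2.length

namespace Term

def val (v : ℕ → ℕ) : Term → ℕ
  | var x => v x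
  | const c => c

def vars : Term → Finset ℕ
  | var x => {x}
  | const _ => ∅

def consts : Term → Finset ℕ
  | var _ => ∅
  | const c => {c}

end Term

namespace FO

/-- The free variables. -/
def fv : FO → Finset ℕ
  | tru => ∅
  | atom _ ts => ts.toFinset.biUnion Term.vars
  | eq t u => t.vars ∪ u.vars
  | neg φ => φ.fv
  | and φ ψ => φ.fv ∪ ψ.fv
  | or φ ψ => φ.fv ∪ ψ.fv
  | ex x φ => φ.fv.erase x

/-- The formula is over the given schema and mentions only constants from `K`. -/
def Over (schema : List ℕ) (K : Finset ℕ) : FO → Prop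
  | tru => True
  | atom R ts => schema[R]? = some ts.length ∧ ∀ t ∈ ts, t.consts ⊆ K
  | eq t u => t.consts ⊆ K ∧ u.consts ⊆ K
  | neg φ => φ.Over schema K
  | and φ ψ => φ.Over schema K ∧ ψ.Over schema K
  | or φ ψ => φ.Over schema K ∧ ψ.Over schema K
  | ex _ φ => φ.Over schema K

/-- Conjunctive queries. -/
def IsCQ : FO → Prop
  | tru => True
  | atom _ _ => True
  | eq _ _ => True
  | neg _ => False
  | and φ ψ => φ.IsCQ ∧ ψ.IsCQ
  | or _ _ => False
  | ex _ φ => φ.IsCQ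

/-- Unions (finite disjunctions) of conjunctive queries. -/
def IsUCQ : FO → Prop
  | or φ ψ => φ.IsUCQ ∧ ψ.IsUCQ
  | φ => φ.IsCQ

/-- Truth of a formula in the instance `I` under the valuation `v`; constants denote themselves and
quantifiers range over `D`. -/
def Holds (D : Finset ℕ) (I : Inst) : (ℕ → ℕ) → FO → Prop
  | _, tru => True
  | v, atom R ts => (R, ts.map (Term.val v)) ∈ I
  | v, eq t u => t.val v = u.val v
  | v, neg φ => ¬ Holds D I v φ
  | v, and φ ψ => Holds D I v φ ∧ Holds D I v ψ
  | v, or φ ψ => Holds D I v φ ∨ Holds D I v ψ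
  | v, ex x φ => ∃ d ∈ D, Holds D I (Function.update v x d) φ

/-- `v`, restricted to the free variables of `Q`, is an answer to `Q` over `I` with evaluation
domain `D`. -/
def IsAnswer (D : Finset ℕ) (I : Inst) (Q : FO) (v : ℕ → ℕ) : Prop :=
  (∀ x ∈ Q.fv, v x ∈ D) ∧ Q.Holds D I v

end FO

/-! ### Data-centric dynamic systems -/

/-- An equality constraint `Q → ⋀ⱼ zⱼ = yⱼ`. -/
structure EqConstraint where
  query : FO
  eqs : List (Term × Term)

/-- Terms of effects: plain terms, and service calls `f(t₁, …, tₙ)` (Skolem terms). -/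
inductive ETerm
  | plain (t : Term)
  | call (f : ℕ) (args : List Term)

/-- An effect specification `q⁺ ∧ Q⁻ ⇝ E`, where `E` is a set of facts over effect terms. -/
structure Effect where
  qpos : FO
  qneg : FO
  facts : List (ℕ × List ETerm)

/-- An action: its input parameters (named as variables) and its effect specifications. -/
structure Action where
  params : List ℕ
  effects : List Effect

/-- The presentation of a DCDS. The data layer consists of the schema (arities of the relation
symbols `0, 1, …`), the equality constraints and the initial instance. The process layer consists of
the service symbols `0, 1, …` (their arities), the actions, and the condition-action rules
`Q ↦ α` with `α` given by its position in the list of actions. -/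
structure System where
  schema : List ℕ
  constraints : List EqConstraint
  init : List Fact
  services : List ℕ
  actions : List Action
  rules : List (FO × ℕ)

/-- A ground service call `f(c₁, …, cₙ)`. -/
abbrev Call := ℕ × List ℕ

/-- Ground effect terms: values or ground service calls. -/
abbrev GTerm := ℕ ⊕ Call

namespace ETerm

def ground (v : ℕ → ℕ) : ETerm → GTerm
  | plain t => Sum.inl (t.val v)
  | call f args => Sum.inr (f, args.map (Term.val v))

/-- The variables among `X`, constants among `K`, services among those declared. -/
def Over (services : List ℕ) (K X : Finset ℕ) : ETerm → Prop
  | plain t => t.consts ⊆ K ∧ t.vars ⊆ X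
  | call f args => services[f]? = some args.length ∧ ∀ t ∈ args, t.consts ⊆ K ∧ t.vars ⊆ X

end ETerm

namespace System

/-- The initial database instance `I₀`. -/
def I₀ (S : System) : Inst := S.init.toFinset

/-- The evaluation domain of queries over `I`: the values of `I`, and those of the initial instance,
which are the values that the constants of the system denote. -/
def dom (S : System) (I : Inst) : Finset ℕ := adom I ∪ adom S.I₀

/-- `I` satisfies the equality constraints. -/
def Satisfies (S : System) (I : Inst) : Prop :=
  ∀ c ∈ S.constraints, ∀ v, c.query.IsAnswer (S.dom I) I v → ∀ e ∈ c.eqs, e.1.val v = e.2.val v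

/-- The well-formedness conditions in the definition of a DCDS. All constants that occur in the
specification belong to the active domain of the initial instance. -/
structure WellFormed (S : System) : Prop where
  init_conforms : ∀ F ∈ S.I₀, Conforms S.schema F
  init_satisfies : S.Satisfies S.I₀
  constraints : ∀ c ∈ S.constraints, c.query.Over S.schema (adom S.I₀) ∧
    ∀ e ∈ c.eqs, (e.1.consts ∪ e.2.consts ⊆ adom S.I₀) ∧ (e.1.vars ∪ e.2.vars ⊆ c.query.fv)
  params_nodup : ∀ α ∈ S.actions, α.params.Nodup
  effects : ∀ α ∈ S.actions, ∀ e ∈ α.effects,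
    e.qpos.IsUCQ ∧
    e.qpos.Over S.schema (adom S.I₀) ∧ e.qneg.Over S.schema (adom S.I₀) ∧
    e.qneg.fv ⊆ e.qpos.fv ∪ α.params.toFinset ∧
    ∀ F ∈ e.facts, S.schema[F.1]? = some F.2.length ∧
      ∀ t ∈ F.2, t.Over S.services (adom S.I₀) (e.qpos.fv ∪ α.params.toFinset)
  rules : ∀ r ∈ S.rules, r.1.Over S.schema (adom S.I₀) ∧
    ∃ α, S.actions[r.2]? = some α ∧ r.1.fv = α.params.toFinset

/-- `DO(I, ασ)`: the facts over values and service calls that the effects of `α`, with parameters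
instantiated by `σ`, produce from `I`. -/
def doFacts (S : System) (I : Inst) (α : Action) (σ : ℕ → ℕ) : Set (ℕ × List GTerm) :=
  {G | ∃ e ∈ α.effects, ∃ v : ℕ → ℕ, (∀ p ∈ α.params, v p = σ p) ∧
    (FO.and e.qpos e.qneg).IsAnswer (S.dom I) I v ∧
    ∃ F ∈ e.facts, G = (F.1, F.2.map (ETerm.ground v))}

/-- Replacing the service calls in a fact by their results. Only the values of `θ` at the calls
that occur in the fact matter. -/
def applyEval (θ : Call → ℕ) (G : ℕ × List GTerm) : Fact := (G.1, G.2.map (Sum.elim id θ))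

/-- Concrete execution with nondeterministic services: `I'` results from `I` by executing, by virtue
of some condition-action rule, an action with a legal parameter assignment `σ` and service call
results `θ`, and satisfies the constraints. -/
def Exec (S : System) (I I' : Inst) : Prop :=
  ∃ r ∈ S.rules, ∃ α, S.actions[r.2]? = some α ∧
    ∃ σ : ℕ → ℕ, r.1.IsAnswer (S.dom I) I σ ∧
      ∃ θ : Call → ℕ, (I' : Set Fact) = applyEval θ '' S.doFacts I α σ ∧ S.Satisfies I'

/-- The states of the concrete transition system. -/
def Reachable (S : System) (I : Inst) : Prop := Relation.ReflTransGen S.Exec S.I₀ I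

/-- One bound limits the size of the active domain of every reachable state. -/
def StateBounded (S : System) : Prop := ∃ b : ℕ, ∀ I, S.Reachable I → (adom I).card < b

end System

/-! ### Transition systems -/

/-- A transition system over the values `ℕ` whose states are labelled by database instances. -/
structure TS where
  State : Type
  init : State
  db : State → Inst
  step : State → State → Prop

/-- The concrete transition system of a DCDS with nondeterministic services. -/
def System.concrete (S : System) : TS where
  State := {I : Inst // S.Reachable I}
  init := ⟨S.I₀, Relation.ReflTransGen.refl⟩
  db := Subtype.val
  step := fun I J => S.Exec I.1 J.1

namespace TS

/-- The transition system with states `P` and transitions `E`, inside `T`. -/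
def sub (T : TS) (P : Set T.State) (E : T.State → T.State → Prop) (h : T.init ∈ P) : TS where
  State := P
  init := ⟨T.init, h⟩
  db := fun s => T.db s.1
  step := fun s t => E s.1 t.1

/-- The values of the initial database, denoted by the constants. -/
def const (T : TS) : Finset ℕ := adom (T.db T.init)

/-- The evaluation domain of queries at a state. -/
def dom (T : TS) (s : T.State) : Finset ℕ := adom (T.db s) ∪ T.const

end TS

/-- `h` induces an isomorphism from `I` to `J` that fixes the constants in `K`. (Only the values of
`h` on `adom I ∪ K` matter.) -/
def IsIso (K : Finset ℕ) (h : ℕ → ℕ) (I J : Inst) : Prop :=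
  (∀ c ∈ K, h c = c) ∧ Set.InjOn h (adom I ∪ K : Finset ℕ) ∧
    J = I.image fun F => (F.1, F.2.map h)

/-- `h'`, as a bijection on `adom I'`, agrees with `h`, as a bijection on `adom I`, on the values
that persist from `I` to `I'`, and their inverses agree on the values that persist on the other
side. -/
def Compatible (h h' : ℕ → ℕ) (I I' : Inst) : Prop :=
  ∀ x ∈ adom I, ∀ y ∈ adom I', h x = h' y ↔ x = y

/-- `B` is a persistence-preserving bisimulation between `T₁` and `T₂`. -/
structure IsPersistenceBisimulation (T₁ T₂ : TS)
    (B : T₁.State → (ℕ → ℕ) → T₂.State → Prop) : Prop where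
  iso : ∀ s₁ h s₂, B s₁ h s₂ → IsIso T₁.const h (T₁.db s₁) (T₂.db s₂)
  forth : ∀ s₁ h s₂, B s₁ h s₂ → ∀ s₁', T₁.step s₁ s₁' →
    ∃ s₂' h', T₂.step s₂ s₂' ∧ Compatible h h' (T₁.db s₁) (T₁.db s₁') ∧ B s₁' h' s₂'
  back : ∀ s₁ h s₂, B s₁ h s₂ → ∀ s₂', T₂.step s₂ s₂' →
    ∃ s₁' h', T₁.step s₁ s₁' ∧ Compatible h h' (T₁.db s₁) (T₁.db s₁') ∧ B s₁' h' s₂'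

/-- Persistence-preserving bisimilarity. -/
def PersistenceBisimilar (T₁ T₂ : TS) : Prop :=
  ∃ B, IsPersistenceBisimulation T₁ T₂ B ∧ ∃ h, B T₁.init h T₂.init

/-! ### The logic -/

/-- Raw formulae of the persistence-preserving first-order mu-calculus:
`ex x Φ` is `∃x. LIVE(x) ∧ Φ`, `dia xs Φ` is `⟨−⟩(LIVE(xs) ∧ Φ)`, `box xs Φ` is `[−](LIVE(xs) ∧ Φ)`,
`pvar Z` is the predicate variable `Z`, `mu Z Φ` is the least fixpoint `μZ.Φ`. -/
inductive MuLP
  | query (Q : FO)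
  | neg (Φ : MuLP)
  | and (Φ Ψ : MuLP)
  | ex (x : ℕ) (Φ : MuLP)
  | dia (xs : List ℕ) (Φ : MuLP)
  | box (xs : List ℕ) (Φ : MuLP)
  | pvar (Z : ℕ)
  | mu (Z : ℕ) (Φ : MuLP)

namespace MuLP

/-- The extension of a formula under an individual valuation and a predicate valuation. -/
def sem (T : TS) : MuLP → (ℕ → ℕ) → (ℕ → Set T.State) → Set T.State
  | query Q, v, _ => {s | Q.Holds (T.dom s) (T.db s) v}
  | neg Φ, v, V => (sem T Φ v V)ᶜ
  | and Φ Ψ, v, V => sem T Φ v V ∩ sem T Ψ v V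
  | ex x Φ, v, V => {s | ∃ d ∈ adom (T.db s), s ∈ sem T Φ (Function.update v x d) V}
  | dia xs Φ, v, V =>
      {s | ∃ s', T.step s s' ∧ (∀ x ∈ xs, v x ∈ adom (T.db s')) ∧ s' ∈ sem T Φ v V}
  | box xs Φ, v, V =>
      {s | ∀ s', T.step s s' → (∀ x ∈ xs, v x ∈ adom (T.db s')) ∧ s' ∈ sem T Φ v V}
  | pvar Z, _, V => V Z
  | mu Z Φ, v, V => ⋂₀ {X | sem T Φ v (Function.update V Z X) ⊆ X}

/-- The free predicate variables. -/
def freePreds : MuLP → Finset ℕ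
  | query _ => ∅
  | neg Φ => Φ.freePreds
  | and Φ Ψ => Φ.freePreds ∪ Ψ.freePreds
  | ex _ Φ => Φ.freePreds
  | dia _ Φ => Φ.freePreds
  | box _ Φ => Φ.freePreds
  | pvar Z => {Z}
  | mu Z Φ => Φ.freePreds.erase Z

/-- The free individual variables, where a free predicate variable `Z` stands for a formula with
free individual variables `ρ Z`. -/
def freeVars : MuLP → (ℕ → Finset ℕ) → Finset ℕ
  | query Q, _ => Q.fv
  | neg Φ, ρ => Φ.freeVars ρ
  | and Φ Ψ, ρ => Φ.freeVars ρ ∪ Ψ.freeVars ρ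
  | ex x Φ, ρ => (Φ.freeVars ρ).erase x
  | dia xs Φ, ρ => xs.toFinset ∪ Φ.freeVars ρ
  | box xs Φ, ρ => xs.toFinset ∪ Φ.freeVars ρ
  | pvar Z, ρ => ρ Z
  | mu Z Φ, ρ => Φ.freeVars (Function.update ρ Z ∅)

/-- The guard condition: in `⟨−⟩(LIVE(xs) ∧ Φ)` and `[−](LIVE(xs) ∧ Φ)`, the variables `xs` are
exactly the free individual variables of `Φ`, once each bound predicate variable is replaced by the
fixpoint formula that binds it; this replacement captures no variable. -/
def Guarded : MuLP → (ℕ → Finset ℕ) → Prop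
  | query _, _ => True
  | neg Φ, ρ => Φ.Guarded ρ
  | and Φ Ψ, ρ => Φ.Guarded ρ ∧ Ψ.Guarded ρ
  | ex x Φ, ρ => (∀ Z ∈ Φ.freePreds, x ∉ ρ Z) ∧ Φ.Guarded ρ
  | dia xs Φ, ρ => xs.toFinset = Φ.freeVars ρ ∧ Φ.Guarded ρ
  | box xs Φ, ρ => xs.toFinset = Φ.freeVars ρ ∧ Φ.Guarded ρ
  | pvar _, _ => True
  | mu Z Φ, ρ => Φ.Guarded (Function.update ρ Z ((mu Z Φ).freeVars ρ))

/-- Every free occurrence of `Z` is within the scope of an even (for `b = true`) or odd (for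
`b = false`) number of negations. -/
def Parity (Z : ℕ) : Bool → MuLP → Prop
  | _, query _ => True
  | b, neg Φ => Parity Z (!b) Φ
  | b, and Φ Ψ => Parity Z b Φ ∧ Parity Z b Ψ
  | b, ex _ Φ => Parity Z b Φ
  | b, dia _ Φ => Parity Z b Φ
  | b, box _ Φ => Parity Z b Φ
  | b, pvar Y => Y = Z → b = true
  | b, mu Y Φ => Y = Z ∨ Parity Z b Φ

/-- Syntactic monotonicity of all fixpoint subformulae. -/
def Monotonic : MuLP → Prop
  | query _ => True
  | neg Φ => Φ.Monotonic
  | and Φ Ψ => Φ.Monotonic ∧ Ψ.Monotonic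
  | ex _ Φ => Φ.Monotonic
  | dia _ Φ => Φ.Monotonic
  | box _ Φ => Φ.Monotonic
  | pvar _ => True
  | mu Z Φ => Parity Z true Φ ∧ Φ.Monotonic

/-- All local queries are over the schema and use constants from `K` only. -/
def Over (schema : List ℕ) (K : Finset ℕ) : MuLP → Prop
  | query Q => Q.Over schema K
  | neg Φ => Φ.Over schema K
  | and Φ Ψ => Φ.Over schema K ∧ Ψ.Over schema K
  | ex _ Φ => Φ.Over schema K
  | dia _ Φ => Φ.Over schema K
  | box _ Φ => Φ.Over schema K
  | pvar _ => True
  | mu _ Φ => Φ.Over schema K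

/-- `Φ` is a closed formula of the logic, over the schema of `S` and with constants from the initial
instance of `S`. -/
structure IsProperty (S : System) (Φ : MuLP) : Prop where
  conforms : Φ.Over S.schema (adom S.I₀)
  monotonic : Φ.Monotonic
  guarded : Φ.Guarded fun _ => ∅
  no_free_var : Φ.freeVars (fun _ => ∅) = ∅
  no_free_pred : Φ.freePreds = ∅

end MuLP

/-- The closed formula `Φ` holds in `T`, i.e. at its initial state. (The valuations are irrelevant
for closed formulae.) -/
def TS.Models (T : TS) (Φ : MuLP) : Prop := T.init ∈ Φ.sem T (fun _ => 0) (fun _ => ∅)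

/-! ### Effective presentation of the inputs

Formulae are numbered by explicit Gödel numberings; records and lists are coded componentwise. -/

def Term.equiv : Term ≃ ℕ ⊕ ℕ where
  toFun | .var x => .inl x | .const c => .inr c
  invFun | .inl x => .var x | .inr c => .const c
  left_inv t := by cases t <;> rfl
  right_inv t := by cases t <;> rfl

instance : Denumerable Term := Denumerable.ofEquiv _ Term.equiv

namespace FO

def toNat : FO → ℕ
  | tru => 0
  | atom R ts => 6 * Nat.pair R (Encodable.encode ts) + 1
  | eq t u => 6 * Nat.pair (Encodable.encode t) (Encodable.encode u) + 2
  | neg φ => 6 * φ.toNat + 3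
  | and φ ψ => 6 * Nat.pair φ.toNat ψ.toNat + 4
  | or φ ψ => 6 * Nat.pair φ.toNat ψ.toNat + 5
  | ex x φ => 6 * Nat.pair x φ.toNat + 6

def ofNat : ℕ → FO
  | 0 => tru
  | n + 1 =>
    have hm : n / 6 < n + 1 := lt_of_le_of_lt (Nat.div_le_self _ _) (Nat.lt_succ_self _)
    have _h1 : (n / 6).unpair.1 < n + 1 := lt_of_le_of_lt (n / 6).unpair_left_le hm
    have _h2 : (n / 6).unpair.2 < n + 1 := lt_of_le_of_lt (n / 6).unpair_right_le hm
    match n % 6 with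
    | 0 => atom (n / 6).unpair.1 (Denumerable.ofNat _ (n / 6).unpair.2)
    | 1 => eq (Denumerable.ofNat _ (n / 6).unpair.1) (Denumerable.ofNat _ (n / 6).unpair.2)
    | 2 => neg (ofNat (n / 6))
    | 3 => and (ofNat (n / 6).unpair.1) (ofNat (n / 6).unpair.2)
    | 4 => or (ofNat (n / 6).unpair.1) (ofNat (n / 6).unpair.2)
    | _ => ex (n / 6).unpair.1 (ofNat (n / 6).unpair.2)

theorem ofNat_toNat (φ : FO) : ofNat φ.toNat = φ := by
  induction φ <;> simp [toNat, ofNat, Nat.mul_add_div, -Denumerable.ofEquiv_ofNat, *]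

theorem toNat_ofNat (n : ℕ) : (ofNat n).toNat = n := by
  induction n using Nat.strong_induction_on with
  | _ n ih =>
    cases n with
    | zero => simp [ofNat, toNat]
    | succ n =>
      have hm : n / 6 < n + 1 := lt_of_le_of_lt (Nat.div_le_self _ _) (Nat.lt_succ_self _)
      have ih0 := ih _ hm
      have ih1 := ih _ (lt_of_le_of_lt (n / 6).unpair_left_le hm)
      have ih2 := ih _ (lt_of_le_of_lt (n / 6).unpair_right_le hm)
      have hd := Nat.div_add_mod n 6
      have hl : n % 6 < 6 := Nat.mod_lt _ (by decide)
      rw [ofNat]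
      generalize hk : n % 6 = k at *
      interval_cases k <;> simp [toNat, ih0, ih1, ih2, -Denumerable.ofEquiv_ofNat] <;> omega

instance : Denumerable FO := Denumerable.mk' ⟨toNat, ofNat, ofNat_toNat, toNat_ofNat⟩

end FO

namespace MuLP

def toNat : MuLP → ℕ
  | query Q => 8 * Encodable.encode Q
  | neg Φ => 8 * Φ.toNat + 1
  | and Φ Ψ => 8 * Nat.pair Φ.toNat Ψ.toNat + 2
  | ex x Φ => 8 * Nat.pair x Φ.toNat + 3
  | dia xs Φ => 8 * Nat.pair (Encodable.encode xs) Φ.toNat + 4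
  | box xs Φ => 8 * Nat.pair (Encodable.encode xs) Φ.toNat + 5
  | pvar Z => 8 * Z + 6
  | mu Z Φ => 8 * Nat.pair Z Φ.toNat + 7

def ofNat (n : ℕ) : MuLP :=
  if h : n = 0 then query (Denumerable.ofNat _ 0) else
    have hm : n / 8 < n := Nat.div_lt_self (Nat.pos_of_ne_zero h) (by decide)
    have _h1 : (n / 8).unpair.1 < n := lt_of_le_of_lt (n / 8).unpair_left_le hm
    have _h2 : (n / 8).unpair.2 < n := lt_of_le_of_lt (n / 8).unpair_right_le hm
    match n % 8 with
    | 0 => query (Denumerable.ofNat _ (n / 8))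
    | 1 => neg (ofNat (n / 8))
    | 2 => and (ofNat (n / 8).unpair.1) (ofNat (n / 8).unpair.2)
    | 3 => ex (n / 8).unpair.1 (ofNat (n / 8).unpair.2)
    | 4 => dia (Denumerable.ofNat _ (n / 8).unpair.1) (ofNat (n / 8).unpair.2)
    | 5 => box (Denumerable.ofNat _ (n / 8).unpair.1) (ofNat (n / 8).unpair.2)
    | 6 => pvar (n / 8)
    | _ => mu (n / 8).unpair.1 (ofNat (n / 8).unpair.2)

theorem ofNat_toNat (Φ : MuLP) : ofNat Φ.toNat = Φ := by
  induction Φ with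
  | query Q =>
    rw [toNat, ofNat]
    split_ifs with h
    · rw [show (0 : ℕ) = Encodable.encode Q by omega, Denumerable.ofNat_encode]
    · simp
  | _ => rw [toNat, ofNat]; simp [Nat.mul_add_div, *]

theorem toNat_ofNat (n : ℕ) : (ofNat n).toNat = n := by
  induction n using Nat.strong_induction_on with
  | _ n ih =>
    by_cases h : n = 0
    · subst h; rw [ofNat]; simp [toNat]
    · have hm : n / 8 < n := Nat.div_lt_self (Nat.pos_of_ne_zero h) (by decide)
      have ih0 := ih _ hm
      have ih1 := ih _ (lt_of_le_of_lt (n / 8).unpair_left_le hm)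
      have ih2 := ih _ (lt_of_le_of_lt (n / 8).unpair_right_le hm)
      have hd := Nat.div_add_mod n 8
      have hl : n % 8 < 8 := Nat.mod_lt _ (by decide)
      rw [ofNat, dif_neg h]
      generalize hk : n % 8 = k at *
      interval_cases k <;> simp [toNat, ih0, ih1, ih2] <;> omega

instance : Denumerable MuLP := Denumerable.mk' ⟨toNat, ofNat, ofNat_toNat, toNat_ofNat⟩

end MuLP

def EqConstraint.equiv : EqConstraint ≃ FO × List (Term × Term) where
  toFun c := (c.query, c.eqs)
  invFun p := ⟨p.1, p.2⟩
  left_inv _ := rfl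
  right_inv _ := rfl

instance : Primcodable EqConstraint := Primcodable.ofEquiv _ EqConstraint.equiv

def ETerm.equiv : ETerm ≃ Term ⊕ (ℕ × List Term) where
  toFun | .plain t => .inl t | .call f ts => .inr (f, ts)
  invFun | .inl t => .plain t | .inr p => .call p.1 p.2
  left_inv t := by cases t <;> rfl
  right_inv t := by cases t <;> rfl

instance : Primcodable ETerm := Primcodable.ofEquiv _ ETerm.equiv

def Effect.equiv : Effect ≃ FO × FO × List (ℕ × List ETerm) where
  toFun e := (e.qpos, e.qneg, e.facts)
  invFun p := ⟨p.1, p.2.1, p.2.2⟩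
  left_inv _ := rfl
  right_inv _ := rfl

instance : Primcodable Effect := Primcodable.ofEquiv _ Effect.equiv

def Action.equiv : Action ≃ List ℕ × List Effect where
  toFun α := (α.params, α.effects)
  invFun p := ⟨p.1, p.2⟩
  left_inv _ := rfl
  right_inv _ := rfl

instance : Primcodable Action := Primcodable.ofEquiv _ Action.equiv

def System.equiv : System ≃
    List ℕ × List EqConstraint × List Fact × List ℕ × List Action × List (FO × ℕ) where
  toFun S := (S.schema, S.constraints, S.init, S.services, S.actions, S.rules)
  invFun p := ⟨p.1, p.2.1, p.2.2.1, p.2.2.2.1, p.2.2.2.2.1, p.2.2.2.2.2⟩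
  left_inv _ := rfl
  right_inv _ := rfl

instance : Primcodable System := Primcodable.ofEquiv _ System.equiv

end DCDS

namespace DCDS

open Function

/-! ### Renaming values -/

/-! Execution is generic: it commutes with every permutation of the values that fixes `adom S.I₀`
(`System.Exec.mapInst`), because queries see values only up to equality and constants, and a
nondeterministic service may return anything. So the names of fresh values are irrelevant; what
matters is which values persist. From an instance whose evaluation domain has `d` elements, a step
issues only calls with arguments in that domain, so it involves at most `d + callBound S.services d`
values, old and new. In a state-bounded system some pool of values below `N` therefore has room for
every step: each concrete step can be renamed into the pool without disturbing the names in use. By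
conformity to the schema there are only finitely many reachable instances over the pool, and with
all executions between them they form a system bisimilar to the concrete one, through the relation
of all isomorphisms fixing the constants (`System.persistenceBisimilar_concrete`).

Bisimilarity preserves closed formulae (`IsPersistenceBisimulation.transfers_sem`): the guards make
the values of free variables persist across a modality, and on persisting values the old and the new
bijection agree. For a least fixpoint, a pre-fixpoint of one system is pulled back along the
relation to a pre-fixpoint of the other. The pulled-back set transfers in one direction only, so the
induction treats the directions separately and tracks polarities of predicate variables.

For decidability no bound is given, but sufficiency of a pool can be checked. If a finite list of
instances below `N` contains the initial one, is closed under successors below `N`, and satisfies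
the counting inequality at each member, then it presents a system bisimilar to the concrete one
(`System.stateInfos_correct`). The procedure `verify` searches for such a pair of `N` and list and
evaluates the formula on the first one found; boundedness serves only to make the search end
(`System.exists_abstraction`). Test and evaluation are primitive recursive because valuations, sets
of states and tables of call results are all enumerated as finite lists, with course-of-values
recursion on Gödel numbers (`foRec`, `muRec`). -/

/-- The instance obtained by renaming the values along `h`. -/
def mapInst (h : ℕ → ℕ) (I : Inst) : Inst := I.image fun F => (F.1, F.2.map h)

theorem mem_adom {I : Inst} {c : ℕ} : c ∈ adom I ↔ ∃ F ∈ I, c ∈ F.2 := by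
  simp [adom]

theorem adom_mapInst (h : ℕ → ℕ) (I : Inst) : adom (mapInst h I) = (adom I).image h := by
  ext c
  simp only [mem_adom, mapInst, Finset.mem_image]
  constructor
  · rintro ⟨_, ⟨F, hF, rfl⟩, hc⟩
    obtain ⟨a, ha, rfl⟩ := List.mem_map.1 hc
    exact ⟨a, ⟨F, hF, ha⟩, rfl⟩
  · rintro ⟨a, ⟨F, hF, ha⟩, rfl⟩
    exact ⟨_, ⟨F, hF, rfl⟩, List.mem_map.2 ⟨a, ha, rfl⟩⟩

theorem mapInst_mapInst (g h : ℕ → ℕ) (I : Inst) :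
    mapInst g (mapInst h I) = mapInst (g ∘ h) I := by
  simp [mapInst, Finset.image_image, Function.comp_def]

theorem mapInst_congr {g h : ℕ → ℕ} {I : Inst} (e : ∀ c ∈ adom I, g c = h c) :
    mapInst g I = mapInst h I := by
  refine Finset.image_congr fun F hF => ?_
  have : F.2.map g = F.2.map h :=
    List.map_congr_left fun c hc => e c (mem_adom.2 ⟨F, hF, hc⟩)
  simp [this]

theorem mapInst_eq_self {h : ℕ → ℕ} {I : Inst} (e : ∀ c ∈ adom I, h c = c) : mapInst h I = I := by
  rw [mapInst_congr (h := id) e]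
  simp [mapInst]

theorem map_injOn_lists {h : ℕ → ℕ} {D : Finset ℕ} (hD : Set.InjOn h D) :
    ∀ {l m : List ℕ}, (∀ c ∈ l, c ∈ D) → (∀ c ∈ m, c ∈ D) → l.map h = m.map h → l = m
  | [], [], _, _, _ => rfl
  | [], _ :: _, _, _, e => by simp at e
  | _ :: _, [], _, _, e => by simp at e
  | a :: l, b :: m, hl, hm, e => by
    simp only [List.map_cons, List.cons.injEq, List.forall_mem_cons] at *
    exact ⟨hD hl.1 hm.1 e.1, map_injOn_lists hD hl.2 hm.2 e.2⟩

theorem Term.val_of_rename {h v v' : ℕ → ℕ} {K : Finset ℕ} (hK : ∀ c ∈ K, h c = c) {t : Term}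
    (ht : t.consts ⊆ K) (hv : ∀ x ∈ t.vars, v' x = h (v x)) : t.val v' = h (t.val v) := by
  cases t with
  | var x => exact hv x (by simp [vars])
  | const c => exact (hK c (ht (by simp [consts]))).symm

theorem Term.val_mem {v : ℕ → ℕ} {K D : Finset ℕ} (hKD : K ⊆ D) {t : Term}
    (ht : t.consts ⊆ K) (hv : ∀ x ∈ t.vars, v x ∈ D) : t.val v ∈ D := by
  cases t with
  | var x => exact hv x (by simp [vars])
  | const c => exact hKD (ht (by simp [consts, val]))

/-- Active-domain semantics confines every value that a formula can inspect to `D`, so injectivity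
of `h` on `D` alone suffices: atoms and equalities are reflected there, and a quantifier over
`D.image h` is one over `D`. -/
theorem FO.holds_rename {schema : List ℕ} {K D : Finset ℕ} {I : Inst} {h : ℕ → ℕ}
    (hD : Set.InjOn h D) (hI : adom I ⊆ D) (hKD : K ⊆ D) (hK : ∀ c ∈ K, h c = c) (φ : FO) :
    ∀ {v v' : ℕ → ℕ}, φ.Over schema K → (∀ x ∈ φ.fv, v x ∈ D) → (∀ x ∈ φ.fv, v' x = h (v x)) →
      (Holds D I v φ ↔ Holds (D.image h) (mapInst h I) v' φ) := by
  induction φ with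
  | tru => intros; rfl
  | atom R ts =>
    intro v v' ho hv hv'
    simp only [FO.fv, Finset.mem_biUnion, List.mem_toFinset] at hv hv'
    have e : ts.map (Term.val v') = (ts.map (Term.val v)).map h := by
      rw [List.map_map]
      exact List.map_congr_left fun t ht =>
        Term.val_of_rename hK (ho.2 t ht) fun x hx => hv' x ⟨t, ht, hx⟩
    simp only [Holds, e, mapInst, Finset.mem_image, Prod.ext_iff]
    constructor
    · exact fun hm => ⟨_, hm, rfl, rfl⟩
    · rintro ⟨F, hF, rfl, h2⟩
      rw [← map_injOn_lists hD (fun c hc => hI (mem_adom.2 ⟨F, hF, hc⟩)) ?_ h2]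
      · exact hF
      · simp only [List.mem_map, forall_exists_index, and_imp, forall_apply_eq_imp_iff₂]
        exact fun t ht => Term.val_mem hKD (ho.2 t ht) fun x hx => hv x ⟨t, ht, hx⟩
  | eq t u =>
    intro v v' ho hv hv'
    simp only [FO.fv, Finset.mem_union] at hv hv'
    simp only [Holds]
    rw [Term.val_of_rename hK ho.1 fun x hx => hv' x (.inl hx),
      Term.val_of_rename hK ho.2 fun x hx => hv' x (.inr hx)]
    exact (hD.eq_iff (Term.val_mem hKD ho.1 fun x hx => hv x (.inl hx))
      (Term.val_mem hKD ho.2 fun x hx => hv x (.inr hx))).symm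
  | neg φ ih => intro v v' ho hv hv'; exact not_congr (ih ho hv hv')
  | and φ ψ ih1 ih2 =>
    intro v v' ho hv hv'
    simp only [FO.fv, Finset.mem_union] at hv hv'
    exact and_congr (ih1 ho.1 (fun x hx => hv x (.inl hx)) fun x hx => hv' x (.inl hx))
      (ih2 ho.2 (fun x hx => hv x (.inr hx)) fun x hx => hv' x (.inr hx))
  | or φ ψ ih1 ih2 =>
    intro v v' ho hv hv'
    simp only [FO.fv, Finset.mem_union] at hv hv'
    exact or_congr (ih1 ho.1 (fun x hx => hv x (.inl hx)) fun x hx => hv' x (.inl hx))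
      (ih2 ho.2 (fun x hx => hv x (.inr hx)) fun x hx => hv' x (.inr hx))
  | ex x φ ih =>
    intro v v' ho hv hv'
    simp only [FO.fv, Finset.mem_erase] at hv hv'
    simp only [Holds, Finset.exists_mem_image]
    refine exists_congr fun d => and_congr_right fun hd => ih ho (fun y hy => ?_) fun y hy => ?_
    · by_cases hyx : y = x
      · simpa [hyx] using hd
      · simpa [hyx] using hv y ⟨hyx, hy⟩
    · by_cases hyx : y = x
      · simp [hyx]
      · simpa [hyx] using hv' y ⟨hyx, hy⟩

/-! ### Invariance of the logic under persistence-preserving bisimulation -/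

namespace MuLP

/-- Needed for fixpoints: with `X` the free variables of `mu Z Φ`, letting `Z` stand for a formula
with free variables `X` adds nothing beyond `X` to the free variables of the body. -/
theorem freeVars_subset_union (Φ : MuLP) : ∀ {ρ ρ' : ℕ → Finset ℕ} {X : Finset ℕ},
    (∀ Z, ρ' Z ⊆ ρ Z ∪ X) → Φ.freeVars ρ' ⊆ Φ.freeVars ρ ∪ X := by
  induction Φ with
  | query Q => intro ρ ρ' X _; exact Finset.subset_union_left
  | neg Φ ih => intro ρ ρ' X h; exact ih h
  | and Φ Ψ ih1 ih2 =>
    intro ρ ρ' X h x hx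
    have h1 := @ih1 _ _ _ h x
    have h2 := @ih2 _ _ _ h x
    simp only [freeVars, Finset.mem_union] at *
    tauto
  | ex y Φ ih =>
    intro ρ ρ' X h x hx
    have h1 := @ih _ _ _ h x
    simp only [freeVars, Finset.mem_union, Finset.mem_erase] at *
    tauto
  | dia xs Φ ih | box xs Φ ih =>
    intro ρ ρ' X h x hx
    have h1 := @ih _ _ _ h x
    simp only [freeVars, Finset.mem_union] at *
    tauto
  | pvar Z => intro ρ ρ' X h; exact h Z
  | mu Z Φ ih =>
    intro ρ ρ' X h
    refine ih fun Y => ?_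
    by_cases hY : Y = Z
    · simp [hY]
    · simpa [hY] using h Y

end MuLP

/-- `s₁` and `s₂` are related by `B`, and so are the valuations on `X`, with values that are live. -/
def Related {T₁ T₂ : TS} (B : T₁.State → (ℕ → ℕ) → T₂.State → Prop) (X : Finset ℕ)
    (v₁ v₂ : ℕ → ℕ) (s₁ : T₁.State) (h : ℕ → ℕ) (s₂ : T₂.State) : Prop :=
  B s₁ h s₂ ∧ ∀ x ∈ X, v₁ x ∈ adom (T₁.db s₁) ∧ v₂ x = h (v₁ x)

/-- On related states, membership in `A₁` implies membership in `A₂` (for `b = true`), or the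
converse (for `b = false`). -/
def Transfers {T₁ T₂ : TS} (B : T₁.State → (ℕ → ℕ) → T₂.State → Prop) (b : Bool) (X : Finset ℕ)
    (v₁ v₂ : ℕ → ℕ) (A₁ : Set T₁.State) (A₂ : Set T₂.State) : Prop :=
  ∀ s₁ h s₂, Related B X v₁ v₂ s₁ h s₂ → if b then s₁ ∈ A₁ → s₂ ∈ A₂ else s₂ ∈ A₂ → s₁ ∈ A₁

section Invariance

variable {T₁ T₂ : TS} {B : T₁.State → (ℕ → ℕ) → T₂.State → Prop} {X Y : Finset ℕ}
  {v₁ v₂ : ℕ → ℕ} {s₁ : T₁.State} {h : ℕ → ℕ} {s₂ : T₂.State}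

theorem Related.mono (hr : Related B X v₁ v₂ s₁ h s₂) (hYX : Y ⊆ X) :
    Related B Y v₁ v₂ s₁ h s₂ := ⟨hr.1, fun x hx => hr.2 x (hYX hx)⟩

theorem Related.congr {w₁ w₂ : ℕ → ℕ} (hr : Related B X v₁ v₂ s₁ h s₂)
    (h₁ : ∀ x ∈ X, w₁ x = v₁ x) (h₂ : ∀ x ∈ X, w₂ x = v₂ x) : Related B X w₁ w₂ s₁ h s₂ :=
  ⟨hr.1, fun x hx => by rw [h₁ x hx, h₂ x hx]; exact hr.2 x hx⟩

namespace IsPersistenceBisimulation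

theorem adom_image (hB : IsPersistenceBisimulation T₁ T₂ B) (hs : B s₁ h s₂) :
    adom (T₂.db s₂) = (adom (T₁.db s₁)).image h := by
  have h1 := (hB.iso _ _ _ hs).2.2
  rw [h1]
  exact adom_mapInst h _

theorem related_update {x d : ℕ}
    (hr : Related B (X.erase x) v₁ v₂ s₁ h s₂) (hd : d ∈ adom (T₁.db s₁)) :
    Related B X (update v₁ x d) (update v₂ x (h d)) s₁ h s₂ := by
  refine ⟨hr.1, fun y hy => ?_⟩
  by_cases hyx : y = x
  · simp [hyx, hd]
  · simpa [hyx] using hr.2 y (Finset.mem_erase.2 ⟨hyx, hy⟩)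

/-- The two directions of `Compatible` do different work. From right to left it says that `h'`
agrees with `h` on values that persist in the first system, so the valuations stay related. From
left to right it pulls liveness back: a value `v₂ x` that is live in `s₂'` is `h'` of some live
value, which must be `v₁ x`. -/
theorem forth_related (hB : IsPersistenceBisimulation T₁ T₂ B)
    (hr : Related B X v₁ v₂ s₁ h s₂) {s₁' : T₁.State} (hs : T₁.step s₁ s₁') :
    ∃ s₂' h', T₂.step s₂ s₂' ∧ B s₁' h' s₂' ∧
      ((∀ x ∈ X, v₁ x ∈ adom (T₁.db s₁')) →
        (∀ x ∈ X, v₂ x ∈ adom (T₂.db s₂')) ∧ Related B X v₁ v₂ s₁' h' s₂') ∧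
      ((∀ x ∈ X, v₂ x ∈ adom (T₂.db s₂')) → ∀ x ∈ X, v₁ x ∈ adom (T₁.db s₁')) := by
  obtain ⟨s₂', h', hs', hc, hB'⟩ := hB.forth _ _ _ hr.1 _ hs
  have key : ∀ x ∈ X, v₁ x ∈ adom (T₁.db s₁') → v₂ x = h' (v₁ x) := fun x hx hx' =>
    (hr.2 x hx).2.trans ((hc _ (hr.2 x hx).1 _ hx').2 rfl)
  refine ⟨s₂', h', hs', hB', fun hl => ⟨fun x hx => ?_, hB', fun x hx => ⟨hl x hx, ?_⟩⟩,
    fun hl x hx => ?_⟩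
  · rw [hB.adom_image hB', key x hx (hl x hx)]
    exact Finset.mem_image_of_mem _ (hl x hx)
  · exact key x hx (hl x hx)
  · have hx' := hl x hx
    rw [hB.adom_image hB', Finset.mem_image] at hx'
    obtain ⟨y, hy, e⟩ := hx'
    rw [(hc _ (hr.2 x hx).1 _ hy).1 ((hr.2 x hx).2.symm.trans e.symm)]
    exact hy

theorem back_related (hB : IsPersistenceBisimulation T₁ T₂ B)
    (hr : Related B X v₁ v₂ s₁ h s₂) {s₂' : T₂.State} (hs : T₂.step s₂ s₂') :
    ∃ s₁' h', T₁.step s₁ s₁' ∧ B s₁' h' s₂' ∧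
      ((∀ x ∈ X, v₁ x ∈ adom (T₁.db s₁')) →
        (∀ x ∈ X, v₂ x ∈ adom (T₂.db s₂')) ∧ Related B X v₁ v₂ s₁' h' s₂') ∧
      ((∀ x ∈ X, v₂ x ∈ adom (T₂.db s₂')) → ∀ x ∈ X, v₁ x ∈ adom (T₁.db s₁')) := by
  obtain ⟨s₁', h', hs', hc, hB'⟩ := hB.back _ _ _ hr.1 _ hs
  have key : ∀ x ∈ X, v₁ x ∈ adom (T₁.db s₁') → v₂ x = h' (v₁ x) := fun x hx hx' =>
    (hr.2 x hx).2.trans ((hc _ (hr.2 x hx).1 _ hx').2 rfl)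
  refine ⟨s₁', h', hs', hB', fun hl => ⟨fun x hx => ?_, hB', fun x hx => ⟨hl x hx, ?_⟩⟩,
    fun hl x hx => ?_⟩
  · rw [hB.adom_image hB', key x hx (hl x hx)]
    exact Finset.mem_image_of_mem _ (hl x hx)
  · exact key x hx (hl x hx)
  · have hx' := hl x hx
    rw [hB.adom_image hB', Finset.mem_image] at hx'
    obtain ⟨y, hy, e⟩ := hx'
    rw [(hc _ (hr.2 x hx).1 _ hy).1 ((hr.2 x hx).2.symm.trans e.symm)]
    exact hy

/-- The bijection fixes the constants, so it carries one evaluation domain onto the other and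
`FO.holds_rename` applies. -/
theorem query_iff (hB : IsPersistenceBisimulation T₁ T₂ B) (hc : T₁.const = T₂.const)
    {schema : List ℕ} {Q : FO} (ho : Q.Over schema T₁.const)
    (hr : Related B Q.fv v₁ v₂ s₁ h s₂) :
    Q.Holds (T₁.dom s₁) (T₁.db s₁) v₁ ↔ Q.Holds (T₂.dom s₂) (T₂.db s₂) v₂ := by
  obtain ⟨h1, h2, h3⟩ := hB.iso _ _ _ hr.1
  have hd : T₂.dom s₂ = (T₁.dom s₁).image h := by
    rw [TS.dom, TS.dom, Finset.image_union, hB.adom_image hr.1, ← hc]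
    congr 1
    ext c
    simp only [Finset.mem_image]
    exact ⟨fun hc => ⟨c, hc, h1 c hc⟩, by rintro ⟨a, ha, rfl⟩; rwa [h1 a ha]⟩
  rw [hd, h3]
  exact FO.holds_rename h2 Finset.subset_union_left Finset.subset_union_right h1 Q ho
    (fun x hx => Finset.mem_union_left _ (hr.2 x hx).1) fun x hx => (hr.2 x hx).2

/-- Induction on the formula for one direction `b` at a time. The hypothesis on a free predicate
variable offers two cases: its interpretations transfer in both directions, or only in the direction
`b == c` while all its free occurrences have parity `c`. Negation flips `b` and `c` together, so the
condition is inherited. The second case is what the fixpoint needs, since its candidate set is known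
to transfer one way only. -/
theorem transfers_sem (hB : IsPersistenceBisimulation T₁ T₂ B) (hc : T₁.const = T₂.const)
    {schema : List ℕ} (Φ : MuLP) : ∀ {b : Bool} {ρ : ℕ → Finset ℕ} {v₁ v₂ : ℕ → ℕ}
    {V₁ : ℕ → Set T₁.State} {V₂ : ℕ → Set T₂.State},
    Φ.Over schema T₁.const → Φ.Monotonic → Φ.Guarded ρ →
    (∀ Z ∈ Φ.freePreds, ∃ c, (Φ.Parity Z c ∨ Transfers B (b == !c) (ρ Z) v₁ v₂ (V₁ Z) (V₂ Z)) ∧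
      Transfers B (b == c) (ρ Z) v₁ v₂ (V₁ Z) (V₂ Z)) →
    Transfers B b (Φ.freeVars ρ) v₁ v₂ (Φ.sem T₁ v₁ V₁) (Φ.sem T₂ v₂ V₂) := by
  induction Φ with
  | query Q =>
    intro b ρ v₁ v₂ V₁ V₂ ho _ _ _ s₁ h s₂ hr
    have := hB.query_iff hc ho hr
    cases b
    · exact this.2
    · exact this.1
  | neg Φ ih =>
    intro b ρ v₁ v₂ V₁ V₂ ho hm hg hV s₁ h s₂ hr
    have := ih (b := !b) ho hm hg (fun Z hZ => by
      obtain ⟨c, h1, h2⟩ := hV Z hZ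
      refine ⟨!c, ?_, ?_⟩
      · cases b <;> cases c <;> exact h1
      · cases b <;> cases c <;> exact h2) s₁ h s₂ hr
    cases b
    · exact fun h2 h1 => h2 (this h1)
    · exact fun h2 h1 => h2 (this h1)
  | and Φ Ψ ih1 ih2 =>
    intro b ρ v₁ v₂ V₁ V₂ ho hm hg hV s₁ h s₂ hr
    have h1 := ih1 (b := b) ho.1 hm.1 hg.1 (fun Z hZ => by
      obtain ⟨c, h1, h2⟩ := hV Z (Finset.mem_union_left _ hZ)
      exact ⟨c, h1.imp_left And.left, h2⟩) s₁ h s₂ (hr.mono Finset.subset_union_left)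
    have h2 := ih2 (b := b) ho.2 hm.2 hg.2 (fun Z hZ => by
      obtain ⟨c, h1, h2⟩ := hV Z (Finset.mem_union_right _ hZ)
      exact ⟨c, h1.imp_left And.right, h2⟩) s₁ h s₂ (hr.mono Finset.subset_union_right)
    cases b
    · exact fun h => ⟨h1 h.1, h2 h.2⟩
    · exact fun h => ⟨h1 h.1, h2 h.2⟩
  | ex x Φ ih =>
    intro b ρ v₁ v₂ V₁ V₂ ho hm hg hV s₁ h s₂ hr
    have key : ∀ d ∈ adom (T₁.db s₁), _ := fun d hd =>
      ih (b := b) (v₁ := update v₁ x d) (v₂ := update v₂ x (h d)) (V₁ := V₁) (V₂ := V₂)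
        ho hm hg.2 (fun Z hZ => by
          -- Guardedness keeps `x` out of `ρ Z`, so rebinding `x` changes no value on which the
          -- relation for `Z` depends.
          have hx : ∀ (w₁ w₂ : ℕ → ℕ) (d₁ d₂ : ℕ) (c : Bool),
              Transfers B c (ρ Z) w₁ w₂ (V₁ Z) (V₂ Z) →
              Transfers B c (ρ Z) (update w₁ x d₁) (update w₂ x d₂) (V₁ Z) (V₂ Z) :=
            fun w₁ w₂ d₁ d₂ c ht s₁ h s₂ hr => ht s₁ h s₂ (hr.congr
              (fun y hy => (update_of_ne (ne_of_mem_of_not_mem hy (hg.1 Z hZ)) _ _).symm)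
              (fun y hy => (update_of_ne (ne_of_mem_of_not_mem hy (hg.1 Z hZ)) _ _).symm))
          obtain ⟨c, h1, h2⟩ := hV Z hZ
          exact ⟨c, h1.imp_right (hx _ _ _ _ _), hx _ _ _ _ _ h2⟩) s₁ h s₂
        (related_update hr hd)
    cases b
    · rintro ⟨d', hd', hs⟩
      rw [hB.adom_image hr.1, Finset.mem_image] at hd'
      obtain ⟨d, hd, rfl⟩ := hd'
      exact ⟨d, hd, key d hd hs⟩
    · rintro ⟨d, hd, hs⟩
      refine ⟨h d, ?_, key d hd hs⟩
      rw [hB.adom_image hr.1]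
      exact Finset.mem_image_of_mem _ hd
  | dia xs Φ ih =>
    intro b ρ v₁ v₂ V₁ V₂ ho hm hg hV s₁ h s₂ hr
    have hr' : Related B xs.toFinset v₁ v₂ s₁ h s₂ := hr.mono Finset.subset_union_left
    have key := ih (b := b) (v₁ := v₁) (v₂ := v₂) ho hm hg.2 hV
    rw [← hg.1] at key
    cases b
    · rintro ⟨s₂', hs, hl, hs'⟩
      obtain ⟨s₁', h', hst, hB', h1, h2⟩ := hB.back_related hr' hs
      simp only [List.mem_toFinset] at h1 h2
      exact ⟨s₁', hst, h2 hl, key _ _ _ (h1 (h2 hl)).2 hs'⟩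
    · rintro ⟨s₁', hs, hl, hs'⟩
      obtain ⟨s₂', h', hst, hB', h1, h2⟩ := hB.forth_related hr' hs
      simp only [List.mem_toFinset] at h1 h2
      exact ⟨s₂', hst, (h1 hl).1, key _ _ _ (h1 hl).2 hs'⟩
  | box xs Φ ih =>
    intro b ρ v₁ v₂ V₁ V₂ ho hm hg hV s₁ h s₂ hr
    have hr' : Related B xs.toFinset v₁ v₂ s₁ h s₂ := hr.mono Finset.subset_union_left
    have key := ih (b := b) (v₁ := v₁) (v₂ := v₂) ho hm hg.2 hV
    rw [← hg.1] at key
    cases b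
    · intro hs₂ s₁' hs
      obtain ⟨s₂', h', hst, hB', h1, h2⟩ := hB.forth_related hr' hs
      simp only [List.mem_toFinset] at h1 h2
      obtain ⟨hl, hs'⟩ := hs₂ s₂' hst
      exact ⟨h2 hl, key _ _ _ (h1 (h2 hl)).2 hs'⟩
    · intro hs₁ s₂' hs
      obtain ⟨s₁', h', hst, hB', h1, h2⟩ := hB.back_related hr' hs
      simp only [List.mem_toFinset] at h1 h2
      obtain ⟨hl, hs'⟩ := hs₁ s₁' hst
      exact ⟨(h1 hl).1, key _ _ _ (h1 hl).2 hs'⟩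
  | pvar Z =>
    intro b ρ v₁ v₂ V₁ V₂ ho hm hg hV
    obtain ⟨c, h1, h2⟩ := hV Z (Finset.mem_singleton_self Z)
    cases c
    -- A bare variable cannot have odd parity, so for `c = false` the interpretations transfer in
    -- both directions.
    · rcases h1 with h1 | h1
      · cases h1 rfl
      · simpa [MuLP.freeVars, MuLP.sem] using h1
    · simpa [MuLP.freeVars, MuLP.sem] using h2
  | mu Z Φ ih =>
    intro b ρ v₁ v₂ V₁ V₂ ho hm hg hV s₁ h s₂ hr
    set X := (MuLP.mu Z Φ).freeVars ρ with hX
    -- The guards of the body are read with `Z` standing for the whole fixpoint formula; relatedness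
    -- on `X` must therefore cover the free variables computed in that way.
    have hsub : Φ.freeVars (update ρ Z X) ⊆ X := by
      refine (Φ.freeVars_subset_union (ρ := update ρ Z ∅) (X := X) fun Y => ?_).trans
        (Finset.union_subset subset_rfl subset_rfl)
      by_cases hY : Y = Z
      · simp [hY]
      · simp [hY]
    have key : ∀ (A₁ : Set T₁.State) (A₂ : Set T₂.State), Transfers B b X v₁ v₂ A₁ A₂ →
        Transfers B b X v₁ v₂ (Φ.sem T₁ v₁ (update V₁ Z A₁)) (Φ.sem T₂ v₂ (update V₂ Z A₂)) := by
      intro A₁ A₂ hA s₁ h s₂ hr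
      refine ih (b := b) ho hm.2 hg (fun Y hY => ?_) s₁ h s₂ (hr.mono hsub)
      by_cases hYZ : Y = Z
      · subst hYZ
        -- Syntactic monotonicity makes `Z` positive in the body, so transfer in the direction `b`
        -- is all that is required of the pair `A₁`, `A₂`.
        refine ⟨true, .inl hm.1, ?_⟩
        simpa using hA
      · obtain ⟨c, h1, h2⟩ := hV Y (Finset.mem_erase.2 ⟨hYZ, hY⟩)
        refine ⟨c, ?_, ?_⟩
        · simp only [update_of_ne hYZ]
          exact h1.imp_left fun h => h.resolve_left (Ne.symm hYZ)
        · simpa only [update_of_ne hYZ] using h2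
    -- Given a pre-fixpoint on the target side, take the largest set on the other side that
    -- transfers into it. By `key` this set is again a pre-fixpoint, so it contains the least
    -- fixpoint.
    cases b
    · intro hs A₁ hA₁
      have := hs {s₂ | ∀ s₁ h, Related B X v₁ v₂ s₁ h s₂ → s₁ ∈ A₁} fun t₂ ht₂ t₁ g hg =>
        hA₁ (key A₁ {s₂ | ∀ s₁ h, Related B X v₁ v₂ s₁ h s₂ → s₁ ∈ A₁}
          (fun s₁ h s₂ hr hs => hs _ _ hr) t₁ g t₂ hg ht₂)
      exact this _ _ hr
    · intro hs A₂ hA₂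
      have := hs {s₁ | ∀ h s₂, Related B X v₁ v₂ s₁ h s₂ → s₂ ∈ A₂} fun t₁ ht₁ g t₂ hg =>
        hA₂ (key {s₁ | ∀ h s₂, Related B X v₁ v₂ s₁ h s₂ → s₂ ∈ A₂} A₂
          (fun s₁ h s₂ hr hs => hs _ _ hr) t₁ g t₂ hg ht₁)
      exact this _ _ hr

end IsPersistenceBisimulation

/-- Persistence-preserving bisimilar systems satisfy the same closed formulae. -/
theorem PersistenceBisimilar.models_iff (hT : PersistenceBisimilar T₁ T₂) {schema : List ℕ}
    {Φ : MuLP} (ho : Φ.Over schema T₁.const) (hm : Φ.Monotonic) (hg : Φ.Guarded fun _ => ∅)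
    (hv : Φ.freeVars (fun _ => ∅) = ∅) (hp : Φ.freePreds = ∅) : T₁.Models Φ ↔ T₂.Models Φ := by
  obtain ⟨B, hB, h, h0⟩ := hT
  -- At the initial states the isomorphism fixes every value of the database, so both initial
  -- databases coincide.
  have hc : T₁.const = T₂.const := by
    rw [TS.const, TS.const, show T₂.db T₂.init = _ from (hB.iso _ _ _ h0).2.2]
    exact congrArg adom (mapInst_eq_self (hB.iso _ _ _ h0).1).symm
  have key := fun b => hB.transfers_sem hc (b := b) (v₁ := fun _ => 0) (v₂ := fun _ => 0)
    (V₁ := fun _ => ∅) (V₂ := fun _ => ∅) Φ ho hm hg (by simp [hp]) T₁.init h T₂.init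
    ⟨h0, by simp [hv]⟩
  exact ⟨key true, key false⟩

end Invariance

end DCDS

namespace DCDS

open Function

/-! ### Lists of a given length -/

/-- The lists of length `n` with entries from `l`. -/
def lists {α : Type*} (n : ℕ) (l : List α) : List (List α) :=
  n.rec [[]] fun _ ls => l.flatMap fun a => ls.map (a :: ·)

theorem mem_lists {α : Type*} {l : List α} : ∀ {n : ℕ} {w : List α},
    w ∈ lists n l ↔ w.length = n ∧ ∀ a ∈ w, a ∈ l
  | 0, w => by
    change w ∈ [[]] ↔ _
    simp only [List.mem_singleton, List.length_eq_zero_iff]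
    exact ⟨fun h => ⟨h, by simp [h]⟩, And.left⟩
  | n + 1, w => by
    have ih : ∀ w, w ∈ lists n l ↔ w.length = n ∧ ∀ a ∈ w, a ∈ l := fun w => mem_lists
    change w ∈ l.flatMap (fun a => (lists n l).map (a :: ·)) ↔ _
    simp only [List.mem_flatMap, List.mem_map, ih]
    constructor
    · rintro ⟨a, ha, u, ⟨rfl, hu⟩, rfl⟩
      exact ⟨rfl, List.forall_mem_cons.2 ⟨ha, hu⟩⟩
    · rintro ⟨h1, h2⟩
      cases w with
      | nil => simp at h1
      | cons a u =>
        exact ⟨a, h2 a (by simp), u, ⟨by simpa using h1, fun b hb => h2 b (by simp [hb])⟩, rfl⟩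

theorem length_lists {α : Type*} (n : ℕ) (l : List α) : (lists n l).length = l.length ^ n := by
  induction n with
  | zero => rfl
  | succ n ih =>
    change (l.flatMap fun a => (lists n l).map (a :: ·)).length = _
    simp [List.length_flatMap, ih, pow_succ, mul_comm]

/-- The service calls with arguments from `D`. -/
def callList (services D : List ℕ) : List Call :=
  (List.range services.length).flatMap fun f => (lists (services.getD f 0) D).map fun w => (f, w)

theorem mem_callList {services D : List ℕ} {c : Call} :
    c ∈ callList services D ↔ services[c.1]? = some c.2.length ∧ ∀ a ∈ c.2, a ∈ D := by
  obtain ⟨f, w⟩ := c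
  simp only [callList, List.mem_flatMap, List.mem_range, List.mem_map, mem_lists, Prod.mk.injEq]
  constructor
  · rintro ⟨f, hf, w, ⟨h1, h2⟩, rfl, rfl⟩
    exact ⟨by simp [hf, h1], h2⟩
  · rintro ⟨h1, h2⟩
    obtain ⟨hf, e⟩ := List.getElem?_eq_some_iff.1 h1
    exact ⟨f, hf, w, ⟨by simp [hf, e], h2⟩, rfl, rfl⟩

/-- The number of service calls with arguments from a set of size `d`. -/
def callBound (services : List ℕ) (d : ℕ) : ℕ :=
  ((List.range services.length).map fun f => d ^ services.getD f 0).sum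

theorem length_callList (services D : List ℕ) :
    (callList services D).length = callBound services D.length := by
  simp [callList, callBound, List.length_flatMap, length_lists]

theorem callBound_mono (services : List ℕ) : Monotone (callBound services) := fun _ _ h =>
  List.sum_le_sum fun _ _ => Nat.pow_le_pow_left h _

/-! ### Extending finite partial injections to permutations -/

/-- Enumerating `A` turns `h` into a pair of tuples of distinct values, and the permutations of `ℕ`
act transitively on such tuples. -/
theorem exists_perm_extending (A : Finset ℕ) {h : ℕ → ℕ} (hA : Set.InjOn h A) :
    ∃ g : Equiv.Perm ℕ, ∀ a ∈ A, g a = h a := by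
  let e := A.equivFin
  let x : Fin A.card ↪ ℕ := ⟨fun i => e.symm i, fun i j hij => by simpa using hij⟩
  let y : Fin A.card ↪ ℕ := ⟨fun i => h (e.symm i), fun i j hij => by
    simpa using hA (e.symm i).2 (e.symm j).2 hij⟩
  obtain ⟨g, hg⟩ := (Equiv.Perm.isMultiplyPretransitive ℕ A.card).exists_smul_eq x y
  refine ⟨g, fun a ha => ?_⟩
  have h1 : g (e.symm (e ⟨a, ha⟩)) = h (e.symm (e ⟨a, ha⟩)) := DFunLike.congr_fun hg (e ⟨a, ha⟩)
  rwa [Equiv.symm_apply_apply] at h1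

/-- A count: `h` uses up `A.card` elements of `C`, and `hcard` leaves at least `(B \ A).card`
others. Send `B \ A` injectively to those, keep `h` on `A`, and extend to a permutation. -/
theorem exists_perm_extending_into (A B C : Finset ℕ) {h : ℕ → ℕ} (hA : Set.InjOn h A)
    (hC : ∀ a ∈ A, h a ∈ C) (hcard : (A ∪ B).card ≤ C.card) :
    ∃ g : Equiv.Perm ℕ, (∀ a ∈ A, g a = h a) ∧ ∀ b ∈ B, g b ∈ C := by
  have h1 : (B \ A).card ≤ (C \ A.image h).card := by
    have e1 : (C \ A.image h).card = C.card - A.card := by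
      rw [Finset.card_sdiff_of_subset, Finset.card_image_of_injOn hA]
      simpa [Finset.subset_iff] using hC
    have e2 := Finset.card_sdiff_add_card B A
    rw [Finset.union_comm] at hcard
    omega
  obtain ⟨e⟩ : Nonempty (↥(B \ A) ↪ ↥(C \ A.image h)) :=
    Function.Embedding.nonempty_of_card_le (by simpa using h1)
  let k : ℕ → ℕ := fun x => if hx : x ∈ B \ A then e ⟨x, hx⟩ else h x
  have kA : ∀ a ∈ A, k a = h a := fun a ha => by simp [k, ha]
  have kB : ∀ b (hb : b ∈ B \ A), k b = e ⟨b, hb⟩ := fun b hb => dif_pos hb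
  have kB' : ∀ b ∈ B \ A, k b ∈ C ∧ ∀ a ∈ A, k b ≠ k a := fun b hb => by
    have := (e ⟨b, hb⟩).2
    rw [← kB b hb, Finset.mem_sdiff] at this
    exact ⟨this.1, fun a ha e => this.2 (by rw [e, kA a ha]; exact Finset.mem_image_of_mem _ ha)⟩
  have split : ∀ x ∈ A ∪ B, x ∈ A ∨ x ∈ B \ A := fun x hx => by
    simp only [Finset.mem_union, Finset.mem_sdiff] at *
    tauto
  obtain ⟨g, hg⟩ := exists_perm_extending (A ∪ B) (h := k) (fun x hx y hy hxy => by
    rcases split x hx with hx | hx <;> rcases split y hy with hy | hy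
    · exact hA hx hy (by rwa [← kA x hx, ← kA y hy])
    · exact ((kB' y hy).2 x hx hxy.symm).elim
    · exact ((kB' x hx).2 y hy hxy).elim
    · rw [kB x hx, kB y hy] at hxy
      simpa using hxy)
  refine ⟨g, fun a ha => (hg a (Finset.mem_union_left _ ha)).trans (kA a ha), fun b hb => ?_⟩
  rw [hg b (Finset.mem_union_right _ hb)]
  rcases split b (Finset.mem_union_right _ hb) with hb | hb
  · rw [kA b hb]; exact hC b hb
  · exact (kB' b hb).1

/-! ### Invariance of the execution under renaming -/

namespace System

variable {S : System} {I I' : Inst}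

/-- Renaming the values in a fact over values and service calls. -/
def mapGround (g : ℕ → ℕ) (G : ℕ × List GTerm) : ℕ × List GTerm :=
  (G.1, G.2.map (Sum.map g fun c => (c.1, c.2.map g)))

theorem dom_mapInst {g : ℕ → ℕ} (hg : ∀ c ∈ adom S.I₀, g c = c) :
    S.dom (mapInst g I) = (S.dom I).image g := by
  rw [dom, dom, Finset.image_union, adom_mapInst]
  congr 1
  ext c
  simp only [Finset.mem_image]
  exact ⟨fun hc => ⟨c, hc, hg c hc⟩, by rintro ⟨a, ha, rfl⟩; rwa [hg a ha]⟩

theorem perm_symm_fixes {g : Equiv.Perm ℕ} {K : Finset ℕ} (hg : ∀ c ∈ K, g c = c) :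
    ∀ c ∈ K, g.symm c = c := fun c hc => by
  rw [Equiv.symm_apply_eq, hg c hc]

theorem mapInst_symm_mapInst (g : Equiv.Perm ℕ) : mapInst g.symm (mapInst g I) = I := by
  rw [mapInst_mapInst, mapInst_eq_self (by simp)]

theorem isAnswer_mapInst {g : Equiv.Perm ℕ} (hg : ∀ c ∈ adom S.I₀, g c = c) {Q : FO}
    {schema : List ℕ} (ho : Q.Over schema (adom S.I₀)) {v : ℕ → ℕ}
    (hv : Q.IsAnswer (S.dom I) I v) :
    Q.IsAnswer (S.dom (mapInst g I)) (mapInst g I) (g ∘ v) := by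
  rw [dom_mapInst hg]
  exact ⟨fun x hx => Finset.mem_image_of_mem _ (hv.1 x hx),
    (FO.holds_rename g.injective.injOn Finset.subset_union_left Finset.subset_union_right hg Q ho
      hv.1 fun _ _ => rfl).1 hv.2⟩

/-- An answer over the renamed instance is pulled back by the inverse permutation, where the
constraint holds. -/
theorem Satisfies.mapInst (hS : S.WellFormed) {g : Equiv.Perm ℕ}
    (hg : ∀ c ∈ adom S.I₀, g c = c) (hI : S.Satisfies I) : S.Satisfies (mapInst g I) := by
  intro c hc v hv e he
  have hg' := perm_symm_fixes hg
  obtain ⟨ho, hE⟩ := hS.constraints c hc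
  have hv' := isAnswer_mapInst hg' ho hv
  rw [mapInst_symm_mapInst] at hv'
  have h1 := hI c hc _ hv' e he
  have h2 := Finset.union_subset_iff.1 (hE e he).1
  rw [Term.val_of_rename (v := v) (v' := g.symm ∘ v) hg' h2.1 fun _ _ => rfl,
    Term.val_of_rename (v := v) (v' := g.symm ∘ v) hg' h2.2 fun _ _ => rfl] at h1
  exact g.symm.injective h1

theorem ground_comp {g : ℕ → ℕ} {K : Finset ℕ} (hg : ∀ c ∈ K, g c = c) {services : List ℕ}
    {X : Finset ℕ} {t : ETerm} (ht : t.Over services K X) (v : ℕ → ℕ) :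
    t.ground (g ∘ v) = Sum.map g (fun c => (c.1, c.2.map g)) (t.ground v) := by
  cases t with
  | plain t =>
    simp only [ETerm.ground, Sum.map_inl]
    rw [Term.val_of_rename (v := v) (v' := g ∘ v) hg ht.1 fun _ _ => rfl]
  | call f args =>
    simp only [ETerm.ground, Sum.map_inr, List.map_map]
    congr 2
    exact List.map_congr_left fun t h => Term.val_of_rename hg (ht.2 t h).1 fun _ _ => rfl

theorem mapGround_mem_doFacts (hS : S.WellFormed) {g : Equiv.Perm ℕ}
    (hg : ∀ c ∈ adom S.I₀, g c = c) {α : Action} (hα : α ∈ S.actions) {σ : ℕ → ℕ}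
    {G : ℕ × List GTerm} (hG : G ∈ S.doFacts I α σ) :
    mapGround g G ∈ S.doFacts (mapInst g I) α (g ∘ σ) := by
  obtain ⟨e, he, v, hv, ha, F, hF, rfl⟩ := hG
  obtain ⟨-, ho1, ho2, -, hE⟩ := hS.effects α hα e he
  refine ⟨e, he, g ∘ v, fun p hp => congrArg g (hv p hp),
    isAnswer_mapInst hg (Q := .and e.qpos e.qneg) (And.intro ho1 ho2) ha, F, hF, ?_⟩
  simp only [mapGround, List.map_map, Prod.mk.injEq, true_and]
  exact List.map_congr_left fun t ht => (ground_comp hg ((hE F hF).2 t ht) v).symm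

theorem mapGround_symm (g : Equiv.Perm ℕ) (G : ℕ × List GTerm) :
    mapGround g (mapGround g.symm G) = G := by
  obtain ⟨R, l⟩ := G
  simp only [mapGround, List.map_map, Prod.mk.injEq, true_and]
  conv_rhs => rw [← List.map_id l]
  refine List.map_congr_left fun t _ => ?_
  cases t <;> simp

/-- One inclusion is `mapGround_mem_doFacts`; the other is the same lemma for the inverse
permutation. -/
theorem doFacts_mapInst (hS : S.WellFormed) {g : Equiv.Perm ℕ}
    (hg : ∀ c ∈ adom S.I₀, g c = c) {α : Action} (hα : α ∈ S.actions) (σ : ℕ → ℕ) :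
    S.doFacts (mapInst g I) α (g ∘ σ) = mapGround g '' S.doFacts I α σ := by
  ext G
  constructor
  · intro hG
    refine ⟨mapGround g.symm G, ?_, mapGround_symm g G⟩
    have := mapGround_mem_doFacts hS (perm_symm_fixes hg) hα hG
    rw [mapInst_symm_mapInst, ← Function.comp_assoc] at this
    simpa using this
  · rintro ⟨G, hG, rfl⟩
    exact mapGround_mem_doFacts hS hg hα hG

/-- Genericity of execution, the source of all freedom to rename. It relies on services being
nondeterministic: call results are chosen afresh at each step, so a renamed choice is as legitimate
as the original. -/
theorem Exec.mapInst (hS : S.WellFormed) {g : Equiv.Perm ℕ}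
    (hg : ∀ c ∈ adom S.I₀, g c = c) (hI : S.Exec I I') :
    S.Exec (mapInst g I) (mapInst g I') := by
  obtain ⟨r, hr, α, hα, σ, hσ, θ, hθ, hs⟩ := hI
  -- The call results are conjugated by `g`: undo the renaming of the arguments, evaluate, rename
  -- the result.
  refine ⟨r, hr, α, hα, g ∘ σ, isAnswer_mapInst hg (hS.rules r hr).1 hσ,
    fun c => g (θ (c.1, c.2.map g.symm)), ?_, hs.mapInst hS hg⟩
  rw [doFacts_mapInst hS hg (List.mem_of_getElem? hα), Set.image_image, DCDS.mapInst,
    Finset.coe_image, hθ, Set.image_image]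
  refine Set.image_congr fun G _ => ?_
  simp only [applyEval, mapGround, List.map_map, Prod.mk.injEq, true_and]
  refine List.map_congr_left fun t _ => ?_
  cases t <;> simp

/-! ### Values and facts of successors -/

theorem ground_cases {D K X : Finset ℕ} (hKD : K ⊆ D) {services : List ℕ} {v : ℕ → ℕ}
    (hv : ∀ x ∈ X, v x ∈ D) {t : ETerm} (ht : t.Over services K X) :
    (∃ c ∈ D, t.ground v = .inl c) ∨
      ∃ c : Call, t.ground v = .inr c ∧ services[c.1]? = some c.2.length ∧ ∀ a ∈ c.2, a ∈ D := by
  cases t with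
  | plain t => exact .inl ⟨_, Term.val_mem hKD ht.1 fun x hx => hv x (ht.2 hx), rfl⟩
  | call f args =>
    refine .inr ⟨_, rfl, by simpa using ht.1, ?_⟩
    simp only [List.mem_map, forall_exists_index, and_imp, forall_apply_eq_imp_iff₂]
    exact fun t h => Term.val_mem hKD (ht.2 t h).1 fun x hx => hv x ((ht.2 t h).2 hx)

/-- Each variable of an effect fact is a free variable of `q⁺` or a parameter. The former have
values in the domain because the effect query is answered there, the latter because parameters are
the free variables of the rule query. -/
theorem mem_doFacts_cases (hS : S.WellFormed) {r : FO × ℕ} (hr : r ∈ S.rules) {α : Action}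
    (hα : S.actions[r.2]? = some α) {σ : ℕ → ℕ} (hσ : r.1.IsAnswer (S.dom I) I σ)
    {G : ℕ × List GTerm} (hG : G ∈ S.doFacts I α σ) :
    S.schema[G.1]? = some G.2.length ∧ ∀ t ∈ G.2, (∃ c ∈ S.dom I, t = .inl c) ∨
      ∃ c : Call, t = .inr c ∧ S.services[c.1]? = some c.2.length ∧ ∀ a ∈ c.2, a ∈ S.dom I := by
  obtain ⟨e, he, v, hv, ha, F, hF, rfl⟩ := hG
  obtain ⟨-, -, -, -, hE⟩ := hS.effects α (List.mem_of_getElem? hα) e he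
  obtain ⟨α', hα', hfv⟩ := (hS.rules r hr).2
  obtain rfl : α = α' := by simpa [hα] using hα'
  refine ⟨by simpa using (hE F hF).1, fun t ht => ?_⟩
  obtain ⟨t, ht', rfl⟩ := List.mem_map.1 ht
  refine ground_cases (Finset.subset_union_right (s₁ := adom I)) (fun x hx => ?_)
    ((hE F hF).2 t ht')
  rcases Finset.mem_union.1 hx with hx | hx
  · exact ha.1 x (Finset.mem_union_left _ hx)
  · rw [hv x (by simpa using hx)]
    exact hσ.1 x (hfv ▸ hx)

theorem Exec.conforms (hS : S.WellFormed) (hI : S.Exec I I') :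
    ∀ F ∈ I', Conforms S.schema F := by
  obtain ⟨r, hr, α, hα, σ, hσ, θ, hθ, hs⟩ := hI
  intro F hF
  rw [← Finset.mem_coe, hθ] at hF
  obtain ⟨G, hG, rfl⟩ := hF
  simpa [Conforms, applyEval] using (mem_doFacts_cases hS hr hα hσ hG).1

/-- A value outside the domain can enter only as the result of a call, and the calls have arguments
in the domain, so they number at most `callBound`. -/
theorem Exec.card_dom_union_le (hS : S.WellFormed) (hI : S.Exec I I') :
    (S.dom I ∪ adom I').card ≤ (S.dom I).card + callBound S.services (S.dom I).card := by
  obtain ⟨r, hr, α, hα, σ, hσ, θ, hθ, hs⟩ := hI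
  have hsub : S.dom I ∪ adom I' ⊆
      S.dom I ∪ (callList S.services (S.dom I).toList).toFinset.image θ := by
    refine Finset.union_subset Finset.subset_union_left fun c hc => ?_
    obtain ⟨F, hF, hc⟩ := mem_adom.1 hc
    rw [← Finset.mem_coe, hθ] at hF
    obtain ⟨G, hG, rfl⟩ := hF
    obtain ⟨t, ht, rfl⟩ := List.mem_map.1 hc
    rcases (mem_doFacts_cases hS hr hα hσ hG).2 t ht with ⟨c, hc', rfl⟩ | ⟨c, rfl, hc'⟩
    · exact Finset.mem_union_left _ hc'
    · refine Finset.mem_union_right _ (Finset.mem_image_of_mem _ ?_)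
      simpa [mem_callList] using hc'
  refine (Finset.card_le_card hsub).trans ((Finset.card_union_le _ _).trans ?_)
  gcongr
  refine Finset.card_image_le.trans ((List.toFinset_card_le _).trans ?_)
  simp [length_callList]

theorem Reachable.conforms (hS : S.WellFormed) (hI : S.Reachable I) :
    ∀ F ∈ I, Conforms S.schema F := by
  cases hI with
  | refl => exact hS.init_conforms
  | tail _ h => exact h.conforms hS

/-! ### Finite abstractions -/

/-- A system whose transitions are the executions with values below `N` is bisimilar to the concrete
transition system, if the values below `N` suffice for executing one step. -/
theorem persistenceBisimilar_concrete (hS : S.WellFormed) {T : TS} {N : ℕ}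
    (hinit : T.db T.init = S.I₀) (hstep : ∀ s t, T.step s t ↔ S.Exec (T.db s) (T.db t))
    (hpool : ∀ s, S.dom (T.db s) ⊆ Finset.range N)
    (hcard : ∀ s, (S.dom (T.db s)).card + callBound S.services (S.dom (T.db s)).card ≤ N)
    (hclosed : ∀ s I', S.Exec (T.db s) I' → adom I' ⊆ Finset.range N → ∃ t, T.db t = I') :
    PersistenceBisimilar T S.concrete := by
  have hconst : T.const = adom S.I₀ := by rw [TS.const, hinit]
  -- No history has to be recorded: any isomorphism fixing the constants relates two states.
  refine ⟨fun s h J => IsIso (adom S.I₀) h (T.db s) J.1, ⟨?_, ?_, ?_⟩, id, ?_⟩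
  · intro s h J hs
    rw [hconst]
    exact hs
  · rintro s h ⟨J, hJ⟩ ⟨h1, h2, h3⟩ s' hs
    -- Extended to a permutation, `h` transports the step itself; the new bijection is the same
    -- permutation, so compatibility is immediate.
    obtain ⟨g, hg⟩ := exists_perm_extending _ h2
    have hgK : ∀ c ∈ adom S.I₀, g c = c := fun c hc =>
      (hg c (Finset.mem_union_right _ hc)).trans (h1 c hc)
    have hgI : ∀ c ∈ adom (T.db s), g c = h c := fun c hc => hg c (Finset.mem_union_left _ hc)
    have hE : S.Exec J (DCDS.mapInst g (T.db s')) := by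
      have := ((hstep s s').1 hs).mapInst hS hgK
      rwa [mapInst_congr hgI, show DCDS.mapInst h (T.db s) = J from h3.symm] at this
    refine ⟨⟨_, hJ.tail hE⟩, g, hE, fun x hx y _ => ?_, hgK, g.injective.injOn, rfl⟩
    rw [← hgI x hx, g.injective.eq_iff]
  · rintro s h ⟨J, hJ⟩ ⟨h1, h2, h3⟩ ⟨J', hJ'⟩ (hE : S.Exec J J')
    obtain ⟨g₀, hg₀⟩ := exists_perm_extending _ h2
    have hg₀K : ∀ c ∈ adom S.I₀, g₀ c = c := fun c hc =>
      (hg₀ c (Finset.mem_union_right _ hc)).trans (h1 c hc)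
    have hg₀I : ∀ c ∈ adom (T.db s), g₀ c = h c := fun c hc =>
      hg₀ c (Finset.mem_union_left _ hc)
    have hJeq : J = DCDS.mapInst g₀ (T.db s) := by
      rw [mapInst_congr hg₀I]
      exact h3
    have hdom : S.dom J = (S.dom (T.db s)).image g₀ := by rw [hJeq, dom_mapInst hg₀K]
    -- The concrete successor may use values outside the pool. Values of `S.dom J` go back to their
    -- names in `s`, which forces compatibility, and the remaining values of `J'` get unused names
    -- below `N`; `hcard` guarantees enough of these.
    obtain ⟨g, hg, hgJ'⟩ := exists_perm_extending_into (S.dom J) (adom J') (Finset.range N)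
      (h := g₀.symm) g₀.symm.injective.injOn (fun a ha => by
        rw [hdom, Finset.mem_image] at ha
        obtain ⟨c, hc, rfl⟩ := ha
        simpa using Finset.mem_range.1 (hpool s hc)) (by
        refine (hE.card_dom_union_le hS).trans ?_
        rw [hdom, Finset.card_image_of_injective _ g₀.injective, Finset.card_range]
        exact hcard s)
    have hgK : ∀ c ∈ adom S.I₀, g c = c := fun c hc =>
      (hg c (Finset.mem_union_right _ hc)).trans (perm_symm_fixes hg₀K c hc)
    have hgJ : DCDS.mapInst g J = T.db s := by
      rw [mapInst_congr (h := g₀.symm) fun c hc => hg c (Finset.mem_union_left _ hc), hJeq,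
        mapInst_symm_mapInst]
    have hE' := hE.mapInst hS hgK
    rw [hgJ] at hE'
    obtain ⟨s', hs'⟩ := hclosed s _ hE' (by
      rw [adom_mapInst]
      intro c hc
      obtain ⟨a, ha, rfl⟩ := Finset.mem_image.1 hc
      exact hgJ' a ha)
    refine ⟨s', g.symm, (hstep s s').2 (hs' ▸ hE'), fun x hx y _ => ?_, perm_symm_fixes hgK,
      g.symm.injective.injOn, ?_⟩
    · have hhx : h x ∈ adom J := by
        rw [hJeq, adom_mapInst, ← hg₀I x hx]
        exact Finset.mem_image_of_mem _ hx
      rw [Equiv.eq_symm_apply, hg _ (Finset.mem_union_left _ hhx), ← hg₀I x hx,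
        Equiv.symm_apply_apply]
    · change J' = DCDS.mapInst g.symm (T.db s')
      rw [hs', mapInst_symm_mapInst]
  · refine ⟨fun _ _ => rfl, Set.injOn_id _, ?_⟩
    change S.I₀ = DCDS.mapInst id _
    rw [hinit, mapInst_eq_self (h := id) fun _ _ => rfl]

/-- State-bounded systems have a sufficient number of values. -/
theorem StateBounded.exists_pool (hb : S.StateBounded) : ∃ N, adom S.I₀ ⊆ Finset.range N ∧
    ∀ I, S.Reachable I → (S.dom I).card + callBound S.services (S.dom I).card ≤ N := by
  obtain ⟨b, hb⟩ := hb
  let d := b + (adom S.I₀).card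
  -- The first part of the sum puts the initial values below `N`; the second bounds one step, as `d`
  -- bounds every evaluation domain and `callBound` is monotone.
  refine ⟨(adom S.I₀).sup id + 1 + (d + callBound S.services d), fun c hc => ?_, fun I hI => ?_⟩
  · have : c ≤ (adom S.I₀).sup id := Finset.le_sup (f := id) hc
    rw [Finset.mem_range]
    omega
  · have h1 : (S.dom I).card ≤ d :=
      (Finset.card_union_le _ _).trans (Nat.add_le_add_right (hb I hI).le _)
    have h2 := callBound_mono S.services h1
    omega

theorem finite_reachable_below (hS : S.WellFormed) (N : ℕ) :
    {I : Inst | S.Reachable I ∧ adom I ⊆ Finset.range N}.Finite := by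
  -- Facts and calls have the same shape, a symbol with a list of values, so `callList` applied to
  -- the schema enumerates all conforming facts over the pool.
  let A : Finset Fact := (callList S.schema (List.range N)).toFinset
  refine A.powerset.finite_toSet.subset fun I hI => ?_
  simp only [Finset.coe_powerset, Set.mem_preimage, Set.mem_powerset_iff]
  intro F hF
  simp only [A, List.coe_toFinset, Set.mem_ofPred_eq, mem_callList, List.mem_range]
  exact ⟨hI.1.conforms hS F hF, fun a ha => Finset.mem_range.1 (hI.2 (mem_adom.2 ⟨F, hF, ha⟩))⟩

theorem dom_subset_range {N : ℕ} (h₀ : adom S.I₀ ⊆ Finset.range N)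
    (hI : adom I ⊆ Finset.range N) : S.dom I ⊆ Finset.range N := Finset.union_subset hI h₀

/-- Bisimilar systems with the same initial state satisfy the same properties. -/
theorem models_iff_of_bisimilar {T : TS} (hinit : T.db T.init = S.I₀)
    (hT : PersistenceBisimilar T S.concrete) {Φ : MuLP} (hΦ : Φ.IsProperty S) :
    T.Models Φ ↔ S.concrete.Models Φ := by
  refine hT.models_iff (schema := S.schema) ?_ hΦ.monotonic hΦ.guarded hΦ.no_free_var
    hΦ.no_free_pred
  rw [TS.const, hinit]
  exact hΦ.conforms

/-- The subsystem consists of all reachable states with values in the pool and all transitions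
between them; an execution from such a state into the pool ends in such a state. -/
theorem exists_finite_abstraction (hS : S.WellFormed) (hb : S.StateBounded) :
    ∃ (P : Set S.concrete.State) (E : S.concrete.State → S.concrete.State → Prop)
      (h : S.concrete.init ∈ P), P.Finite ∧ (∀ s t, E s t → S.concrete.step s t) ∧
      PersistenceBisimilar (S.concrete.sub P E h) S.concrete ∧
      ∀ Φ : MuLP, Φ.IsProperty S →
        ((S.concrete.sub P E h).Models Φ ↔ S.concrete.Models Φ) := by
  obtain ⟨N, h₀, hN⟩ := hb.exists_pool
  have hT : PersistenceBisimilar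
      (S.concrete.sub {s | adom s.1 ⊆ Finset.range N} S.concrete.step h₀) S.concrete :=
    persistenceBisimilar_concrete hS (N := N) rfl (fun _ _ => Iff.rfl)
      (fun s => dom_subset_range h₀ s.2) (fun s => hN _ s.1.2)
      fun s I' hE hI' => ⟨⟨⟨I', s.1.2.tail hE⟩, hI'⟩, rfl⟩
  refine ⟨_, _, h₀, ?_, fun _ _ => id, hT, fun Φ hΦ => models_iff_of_bisimilar rfl hT hΦ⟩
  refine Set.Finite.of_finite_image (f := Subtype.val)
    ((finite_reachable_below hS N).subset ?_) Subtype.val_injective.injOn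
  rintro _ ⟨s, hs, rfl⟩
  exact ⟨s.2, hs⟩

end System

end DCDS

attribute [fun_prop] Primrec

namespace DCDS

/-! ### Primitive recursive functions -/

/-- Equality, as a Boolean function. -/
def eqB {α : Type*} [DecidableEq α] (a b : α) : Bool := decide (a = b)

/-- Membership in a list, as a Boolean function. -/
def memB {α : Type*} [DecidableEq α] (a : α) (l : List α) : Bool := l.any (eqB a)

/-- The position of an element in a list. -/
def index {α : Type*} [DecidableEq α] (a : α) (l : List α) : ℕ := l.idxOf a

/-- The order of the natural numbers, as a Boolean function. -/
def ltB (a b : ℕ) : Bool := decide (a < b)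

@[simp] theorem eqB_iff {α : Type*} [DecidableEq α] {a b : α} : eqB a b = true ↔ a = b := by
  simp [eqB]

@[simp] theorem memB_iff {α : Type*} [DecidableEq α] {a : α} {l : List α} :
    memB a l = true ↔ a ∈ l := by
  simp [memB]

@[simp] theorem ltB_iff {a b : ℕ} : ltB a b = true ↔ a < b := by simp [ltB]

theorem index_lt {α : Type*} [DecidableEq α] {a : α} {l : List α} (h : a ∈ l) :
    index a l < l.length := List.idxOf_lt_length_iff.2 h

theorem getElem_index {α : Type*} [DecidableEq α] {a : α} {l : List α} (h : a ∈ l) :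
    l[index a l]'(index_lt h) = a := List.getElem_idxOf (index_lt h)

/-! ### Closure properties of primitive recursive functions, registered for `fun_prop` -/

namespace PrimrecFun

section

variable {α β γ σ : Type*} [Primcodable α] [Primcodable β] [Primcodable γ] [Primcodable σ]

@[fun_prop] theorem id : Primrec fun a : α => a := Primrec.id

@[fun_prop] theorem const (b : β) : Primrec fun _ : α => b := Primrec.const b

@[fun_prop] theorem comp {f : β → σ} {g : α → β} (hf : Primrec f) (hg : Primrec g) :
    Primrec fun a => f (g a) := hf.comp hg

@[fun_prop] theorem pair {f : α → β} {g : α → γ} (hf : Primrec f) (hg : Primrec g) :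
    Primrec fun a => (f a, g a) := hf.pair hg

@[fun_prop] theorem fst {f : α → β × γ} (hf : Primrec f) : Primrec fun a => (f a).1 :=
  Primrec.fst.comp hf

@[fun_prop] theorem snd {f : α → β × γ} (hf : Primrec f) : Primrec fun a => (f a).2 :=
  Primrec.snd.comp hf

@[fun_prop] theorem inl {f : α → β} (hf : Primrec f) : Primrec fun a => (Sum.inl (f a) : β ⊕ γ) :=
  Primrec.sumInl.comp hf

@[fun_prop] theorem inr {f : α → β} (hf : Primrec f) : Primrec fun a => (Sum.inr (f a) : γ ⊕ β) :=
  Primrec.sumInr.comp hf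

@[fun_prop] theorem sumElim {f : α → β ⊕ γ} {g : α → β → σ} {h : α → γ → σ} (hf : Primrec f)
    (hg : Primrec fun p : α × β => g p.1 p.2) (hh : Primrec fun p : α × γ => h p.1 p.2) :
    Primrec fun a => Sum.elim (g a) (h a) (f a) :=
  (Primrec.sumCasesOn hf hg hh).of_eq fun a => by cases f a <;> rfl

@[fun_prop] theorem some {f : α → β} (hf : Primrec f) : Primrec fun a => Option.some (f a) :=
  Primrec.option_some.comp hf

@[fun_prop] theorem optionToList {f : α → Option β} (hf : Primrec f) :
    Primrec fun a => (f a).toList := Primrec.optionToList.comp hf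

@[fun_prop] theorem optionBind {f : α → Option β} {g : α → β → Option σ} (hf : Primrec f)
    (hg : Primrec fun p : α × β => g p.1 p.2) : Primrec fun a => (f a).bind (g a) :=
  Primrec.option_bind hf hg

@[fun_prop] theorem decode {f : α → ℕ} (hf : Primrec f) :
    Primrec fun a => (Encodable.decode (f a) : Option β) := Primrec.decode.comp hf

@[fun_prop] theorem encode {f : α → β} (hf : Primrec f) :
    Primrec fun a => Encodable.encode (f a) := Primrec.encode.comp hf

@[fun_prop] theorem denumerableOfNat {δ : Type*} [Denumerable δ] {f : α → ℕ} (hf : Primrec f) :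
    Primrec fun a => Denumerable.ofNat δ (f a) := (Primrec.ofNat δ).comp hf

@[fun_prop] theorem unpair {f : α → ℕ} (hf : Primrec f) : Primrec fun a => (f a).unpair :=
  Primrec.unpair.comp hf

@[fun_prop] theorem natPair {f g : α → ℕ} (hf : Primrec f) (hg : Primrec g) :
    Primrec fun a => Nat.pair (f a) (g a) := Primrec₂.natPair.comp hf hg

@[fun_prop] theorem add {f g : α → ℕ} (hf : Primrec f) (hg : Primrec g) :
    Primrec fun a => f a + g a := Primrec.nat_add.comp hf hg

@[fun_prop] theorem sub {f g : α → ℕ} (hf : Primrec f) (hg : Primrec g) :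
    Primrec fun a => f a - g a := Primrec.nat_sub.comp hf hg

@[fun_prop] theorem mul {f g : α → ℕ} (hf : Primrec f) (hg : Primrec g) :
    Primrec fun a => f a * g a := Primrec.nat_mul.comp hf hg

@[fun_prop] theorem div {f g : α → ℕ} (hf : Primrec f) (hg : Primrec g) :
    Primrec fun a => f a / g a := Primrec.nat_div.comp hf hg

@[fun_prop] theorem mod {f g : α → ℕ} (hf : Primrec f) (hg : Primrec g) :
    Primrec fun a => f a % g a := Primrec.nat_mod.comp hf hg

@[fun_prop] theorem eqB [DecidableEq β] {f g : α → β} (hf : Primrec f) (hg : Primrec g) :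
    Primrec fun a => eqB (f a) (g a) := Primrec.eq.decide.comp hf hg

@[fun_prop] theorem ltB {f g : α → ℕ} (hf : Primrec f) (hg : Primrec g) :
    Primrec fun a => ltB (f a) (g a) := Primrec.nat_lt.decide.comp hf hg

@[fun_prop] theorem cond {c : α → Bool} {f g : α → σ} (hc : Primrec c) (hf : Primrec f)
    (hg : Primrec g) : Primrec fun a => bif c a then f a else g a := Primrec.cond hc hf hg

@[fun_prop] theorem not {f : α → Bool} (hf : Primrec f) : Primrec fun a => !f a :=
  Primrec.not.comp hf

@[fun_prop] theorem and {f g : α → Bool} (hf : Primrec f) (hg : Primrec g) :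
    Primrec fun a => f a && g a := Primrec.and.comp hf hg

@[fun_prop] theorem or {f g : α → Bool} (hf : Primrec f) (hg : Primrec g) :
    Primrec fun a => f a || g a := Primrec.or.comp hf hg

@[fun_prop] theorem cons {f : α → β} {g : α → List β} (hf : Primrec f) (hg : Primrec g) :
    Primrec fun a => f a :: g a := Primrec.list_cons.comp hf hg

@[fun_prop] theorem append {f g : α → List β} (hf : Primrec f) (hg : Primrec g) :
    Primrec fun a => f a ++ g a := Primrec.list_append.comp hf hg

@[fun_prop] theorem map {f : α → List β} {g : α → β → σ} (hf : Primrec f)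
    (hg : Primrec fun p : α × β => g p.1 p.2) : Primrec fun a => (f a).map (g a) :=
  Primrec.list_map hf hg

@[fun_prop] theorem flatMap {f : α → List β} {g : α → β → List σ} (hf : Primrec f)
    (hg : Primrec fun p : α × β => g p.1 p.2) : Primrec fun a => (f a).flatMap (g a) :=
  Primrec.list_flatMap hf hg

@[fun_prop] theorem filter {f : α → List β} {g : α → β → Bool} (hf : Primrec f)
    (hg : Primrec fun p : α × β => g p.1 p.2) : Primrec fun a => (f a).filter (g a) :=
  (flatMap (g := fun a b => bif g a b then [b] else []) hf (by fun_prop)).of_eq fun a => by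
    induction f a with
    | nil => rfl
    | cons b l ih => cases h : g a b <;> simp [h, ih]

@[fun_prop] theorem any {f : α → List β} {g : α → β → Bool} (hf : Primrec f)
    (hg : Primrec fun p : α × β => g p.1 p.2) : Primrec fun a => (f a).any (g a) :=
  (Primrec.list_foldr (g := fun _ => false) (h := fun a p => g a p.1 || p.2) hf (const false)
    (or (hg.comp (pair Primrec.fst (fst Primrec.snd))) (snd Primrec.snd)) : Primrec _).of_eq fun a => by
    induction f a with
    | nil => rfl
    | cons b l ih => simp [ih]

@[fun_prop] theorem all {f : α → List β} {g : α → β → Bool} (hf : Primrec f)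
    (hg : Primrec fun p : α × β => g p.1 p.2) : Primrec fun a => (f a).all (g a) :=
  (not (any (g := fun a b => !g a b) hf (not hg))).of_eq fun a => by
    simp [List.all_eq_not_any_not]

@[fun_prop] theorem memB [DecidableEq β] {f : α → β} {g : α → List β} (hf : Primrec f)
    (hg : Primrec g) : Primrec fun a => memB (f a) (g a) := by
  unfold DCDS.memB
  fun_prop

@[fun_prop] theorem range {f : α → ℕ} (hf : Primrec f) : Primrec fun a => List.range (f a) :=
  Primrec.list_range.comp hf

@[fun_prop] theorem length {f : α → List β} (hf : Primrec f) : Primrec fun a => (f a).length :=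
  Primrec.list_length.comp hf

@[fun_prop] theorem getElem? {f : α → List β} {g : α → ℕ} (hf : Primrec f) (hg : Primrec g) :
    Primrec fun a => (f a)[g a]? := Primrec.list_getElem?.comp hf hg

@[fun_prop] theorem getD {f : α → List β} {g : α → ℕ} {h : α → β} (hf : Primrec f)
    (hg : Primrec g) (hh : Primrec h) : Primrec fun a => (f a).getD (g a) (h a) :=
  (Primrec.option_getD.comp (getElem? hf hg) hh).of_eq fun a => by simp

@[fun_prop] theorem set {f : α → List β} {g : α → ℕ} {h : α → β} (hf : Primrec f)
    (hg : Primrec g) (hh : Primrec h) : Primrec fun a => (f a).set (g a) (h a) :=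
  Primrec.list_set.comp hf (hg.pair hh)

@[fun_prop] theorem index [DecidableEq β] {f : α → β} {g : α → List β} (hf : Primrec f)
    (hg : Primrec g) : Primrec fun a => index (f a) (g a) := Primrec.list_idxOf.comp hf hg

@[fun_prop] theorem lists {f : α → ℕ} {g : α → List β} (hf : Primrec f) (hg : Primrec g) :
    Primrec fun a => lists (f a) (g a) :=
  (Primrec.nat_rec' (g := fun _ => [[]])
    (h := fun a (p : ℕ × List (List β)) => (g a).flatMap fun b => p.2.map (b :: ·)) hf (const _)
    (show Primrec fun q : α × ℕ × List (List β) =>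
      (g q.1).flatMap fun b => q.2.2.map (b :: ·) by fun_prop)).of_eq fun _ => rfl

end

/-! ### Access to the coded syntax, and recursion along Gödel numbers -/

section Presentation

variable {α : Type*} [Primcodable α]

-- A term and its image under `Term.equiv` have the same code, so the map amounts to encoding
-- followed by decoding.
@[fun_prop] theorem termEquiv {f : α → Term} (hf : Primrec f) :
    Primrec fun a => Term.equiv (f a) :=
  Primrec.option_some_iff.1 ((Primrec.decode.comp (Primrec.encode.comp hf)).of_eq fun a => by
    change Encodable.decode (Encodable.encode (Term.equiv (f a))) = _
    simp)

@[fun_prop] theorem etermEquiv {f : α → ETerm} (hf : Primrec f) :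
    Primrec fun a => ETerm.equiv (f a) := Primrec.of_equiv.comp hf

@[fun_prop] theorem constraintQuery {f : α → EqConstraint} (hf : Primrec f) :
    Primrec fun a => (f a).query :=
  fst ((Primrec.of_equiv (e := EqConstraint.equiv)).comp hf)

@[fun_prop] theorem constraintEqs {f : α → EqConstraint} (hf : Primrec f) :
    Primrec fun a => (f a).eqs :=
  snd ((Primrec.of_equiv (e := EqConstraint.equiv)).comp hf)

@[fun_prop] theorem effectQpos {f : α → Effect} (hf : Primrec f) : Primrec fun a => (f a).qpos :=
  fst ((Primrec.of_equiv (e := Effect.equiv)).comp hf)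

@[fun_prop] theorem effectQneg {f : α → Effect} (hf : Primrec f) : Primrec fun a => (f a).qneg :=
  fst (snd ((Primrec.of_equiv (e := Effect.equiv)).comp hf))

@[fun_prop] theorem effectFacts {f : α → Effect} (hf : Primrec f) :
    Primrec fun a => (f a).facts :=
  snd (snd ((Primrec.of_equiv (e := Effect.equiv)).comp hf))

@[fun_prop] theorem actionParams {f : α → Action} (hf : Primrec f) :
    Primrec fun a => (f a).params :=
  fst ((Primrec.of_equiv (e := Action.equiv)).comp hf)

@[fun_prop] theorem actionEffects {f : α → Action} (hf : Primrec f) :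
    Primrec fun a => (f a).effects :=
  snd ((Primrec.of_equiv (e := Action.equiv)).comp hf)

theorem systemEquiv {f : α → System} (hf : Primrec f) : Primrec fun a => System.equiv (f a) :=
  Primrec.of_equiv.comp hf

@[fun_prop] theorem systemConstraints {f : α → System} (hf : Primrec f) :
    Primrec fun a => (f a).constraints := fst (snd (systemEquiv hf))

@[fun_prop] theorem systemInit {f : α → System} (hf : Primrec f) : Primrec fun a => (f a).init :=
  fst (snd (snd (systemEquiv hf)))

@[fun_prop] theorem systemServices {f : α → System} (hf : Primrec f) :
    Primrec fun a => (f a).services := fst (snd (snd (snd (systemEquiv hf))))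

@[fun_prop] theorem systemActions {f : α → System} (hf : Primrec f) :
    Primrec fun a => (f a).actions := fst (snd (snd (snd (snd (systemEquiv hf)))))

@[fun_prop] theorem systemRules {f : α → System} (hf : Primrec f) :
    Primrec fun a => (f a).rules := snd (snd (snd (snd (snd (systemEquiv hf)))))

@[fun_prop] theorem foAnd {f g : α → FO} (hf : Primrec f) (hg : Primrec g) :
    Primrec fun a => FO.and (f a) (g a) :=
  Primrec.encode_iff.1 (show Primrec fun a =>
    6 * Nat.pair (Encodable.encode (f a)) (Encodable.encode (g a)) + 4 by fun_prop)

/-- Recursion on first-order formulae. -/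
theorem foRec {σ : Type*} [Primcodable σ] [Inhabited σ] {F : α → FO → σ} {tru : α → σ}
    {atom : α → ℕ → List Term → σ} {eq : α → Term → Term → σ} {neg : α → σ → σ}
    {and or : α → σ → σ → σ} {ex : α → ℕ → σ → σ}
    (htru : Primrec tru)
    (hatom : Primrec fun p : α × ℕ × List Term => atom p.1 p.2.1 p.2.2)
    (heq : Primrec fun p : α × Term × Term => eq p.1 p.2.1 p.2.2)
    (hneg : Primrec fun p : α × σ => neg p.1 p.2)
    (hand : Primrec fun p : α × σ × σ => and p.1 p.2.1 p.2.2)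
    (hor : Primrec fun p : α × σ × σ => or p.1 p.2.1 p.2.2)
    (hex : Primrec fun p : α × ℕ × σ => ex p.1 p.2.1 p.2.2)
    (e0 : ∀ a, F a .tru = tru a) (e1 : ∀ a R ts, F a (.atom R ts) = atom a R ts)
    (e2 : ∀ a t u, F a (.eq t u) = eq a t u) (e3 : ∀ a φ, F a (.neg φ) = neg a (F a φ))
    (e4 : ∀ a φ ψ, F a (.and φ ψ) = and a (F a φ) (F a ψ))
    (e5 : ∀ a φ ψ, F a (.or φ ψ) = or a (F a φ) (F a ψ))
    (e6 : ∀ a x φ, F a (.ex x φ) = ex a x (F a φ)) :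
    Primrec fun p : α × FO => F p.1 p.2 := by
  -- Course-of-values step: `l` lists the results for all smaller codes, so `l.length` is the
  -- current code. Code `0` is `tru` and every other code is `6 * m + r + 1`, whence the subtraction
  -- of one; `default` is never reached, as component codes are smaller.
  let g : α → List σ → σ := fun a l =>
    let m := (l.length - 1) / 6
    let r := (l.length - 1) % 6
    bif DCDS.eqB l.length 0 then tru a else
    bif DCDS.eqB r 0 then atom a m.unpair.1 (Denumerable.ofNat (List Term) m.unpair.2) else
    bif DCDS.eqB r 1 then
      eq a (Denumerable.ofNat Term m.unpair.1) (Denumerable.ofNat Term m.unpair.2) else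
    bif DCDS.eqB r 2 then neg a (l.getD m default) else
    bif DCDS.eqB r 3 then and a (l.getD m.unpair.1 default) (l.getD m.unpair.2 default) else
    bif DCDS.eqB r 4 then or a (l.getD m.unpair.1 default) (l.getD m.unpair.2 default) else
    ex a m.unpair.1 (l.getD m.unpair.2 default)
  have hg : Primrec fun p : α × List σ => g p.1 p.2 := by
    refine cond (by fun_prop) (by fun_prop) ?_
    refine cond (by fun_prop) (hatom.comp (g := fun p : α × List σ =>
      (p.1, ((p.2.length - 1) / 6).unpair.1,
        Denumerable.ofNat (List Term) ((p.2.length - 1) / 6).unpair.2)) (by fun_prop)) ?_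
    refine cond (by fun_prop) (heq.comp (g := fun p : α × List σ =>
      (p.1, Denumerable.ofNat Term ((p.2.length - 1) / 6).unpair.1,
        Denumerable.ofNat Term ((p.2.length - 1) / 6).unpair.2)) (by fun_prop)) ?_
    refine cond (by fun_prop) (hneg.comp (g := fun p : α × List σ =>
      (p.1, p.2.getD ((p.2.length - 1) / 6) default)) (by fun_prop)) ?_
    refine cond (by fun_prop) (hand.comp (g := fun p : α × List σ =>
      (p.1, p.2.getD ((p.2.length - 1) / 6).unpair.1 default,
        p.2.getD ((p.2.length - 1) / 6).unpair.2 default)) (by fun_prop)) ?_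
    refine cond (by fun_prop) (hor.comp (g := fun p : α × List σ =>
      (p.1, p.2.getD ((p.2.length - 1) / 6).unpair.1 default,
        p.2.getD ((p.2.length - 1) / 6).unpair.2 default)) (by fun_prop)) ?_
    exact hex.comp (g := fun p : α × List σ => (p.1, ((p.2.length - 1) / 6).unpair.1,
        p.2.getD ((p.2.length - 1) / 6).unpair.2 default)) (by fun_prop)
  have key := Primrec.nat_strong_rec (fun a n => F a (Denumerable.ofNat FO n))
    (g := fun a l => Option.some (g a l)) (some hg) fun a n => ?_
  · exact (key.comp Primrec.fst (encode Primrec.snd) : Primrec fun p : α × FO => _).of_eq fun p => by simp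
  congr 1
  cases n with
  | zero =>
    change _ = F a (FO.ofNat 0)
    rw [FO.ofNat, e0]
    rfl
  | succ n =>
    have hm : n / 6 < n + 1 := lt_of_le_of_lt (Nat.div_le_self _ _) (Nat.lt_succ_self _)
    have h1 : (n / 6).unpair.1 < n + 1 := lt_of_le_of_lt (n / 6).unpair_left_le hm
    have h2 : (n / 6).unpair.2 < n + 1 := lt_of_le_of_lt (n / 6).unpair_right_le hm
    have hget : ∀ k < n + 1, ((List.range (n + 1)).map fun n =>
        F a (Denumerable.ofNat FO n)).getD k default = F a (FO.ofNat k) := fun k hk => by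
      simp only [List.getD_eq_getElem?_getD, List.getElem?_map, List.getElem?_range hk]
      rfl
    have hl : n % 6 < 6 := Nat.mod_lt _ (by decide)
    change _ = F a (FO.ofNat (n + 1))
    rw [FO.ofNat]
    simp only [g, List.length_map, List.length_range, Nat.add_sub_cancel, hget _ hm, hget _ h1,
      hget _ h2]
    generalize n % 6 = k at *
    interval_cases k <;> simp [DCDS.eqB, *]

/-- Recursion on formulae of the logic. -/
theorem muRec {σ : Type*} [Primcodable σ] [Inhabited σ] {F : α → MuLP → σ}
    {query : α → FO → σ} {neg : α → σ → σ} {and : α → σ → σ → σ} {ex : α → ℕ → σ → σ}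
    {dia box : α → List ℕ → σ → σ} {pvar : α → ℕ → σ} {mu : α → ℕ → σ → σ}
    (hquery : Primrec fun p : α × FO => query p.1 p.2)
    (hneg : Primrec fun p : α × σ => neg p.1 p.2)
    (hand : Primrec fun p : α × σ × σ => and p.1 p.2.1 p.2.2)
    (hex : Primrec fun p : α × ℕ × σ => ex p.1 p.2.1 p.2.2)
    (hdia : Primrec fun p : α × List ℕ × σ => dia p.1 p.2.1 p.2.2)
    (hbox : Primrec fun p : α × List ℕ × σ => box p.1 p.2.1 p.2.2)
    (hpvar : Primrec fun p : α × ℕ => pvar p.1 p.2)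
    (hmu : Primrec fun p : α × ℕ × σ => mu p.1 p.2.1 p.2.2)
    (e0 : ∀ a Q, F a (.query Q) = query a Q) (e1 : ∀ a Φ, F a (.neg Φ) = neg a (F a Φ))
    (e2 : ∀ a Φ Ψ, F a (.and Φ Ψ) = and a (F a Φ) (F a Ψ))
    (e3 : ∀ a x Φ, F a (.ex x Φ) = ex a x (F a Φ))
    (e4 : ∀ a xs Φ, F a (.dia xs Φ) = dia a xs (F a Φ))
    (e5 : ∀ a xs Φ, F a (.box xs Φ) = box a xs (F a Φ))
    (e6 : ∀ a Z, F a (.pvar Z) = pvar a Z)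
    (e7 : ∀ a Z Φ, F a (.mu Z Φ) = mu a Z (F a Φ)) :
    Primrec fun p : α × MuLP => F p.1 p.2 := by
  -- As for `foRec`, but here the current code is `8 * m + r` with no offset.
  let g : α → List σ → σ := fun a l =>
    let m := l.length / 8
    let r := l.length % 8
    bif DCDS.eqB r 0 then query a (Denumerable.ofNat FO m) else
    bif DCDS.eqB r 1 then neg a (l.getD m default) else
    bif DCDS.eqB r 2 then and a (l.getD m.unpair.1 default) (l.getD m.unpair.2 default) else
    bif DCDS.eqB r 3 then ex a m.unpair.1 (l.getD m.unpair.2 default) else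
    bif DCDS.eqB r 4 then
      dia a (Denumerable.ofNat (List ℕ) m.unpair.1) (l.getD m.unpair.2 default) else
    bif DCDS.eqB r 5 then
      box a (Denumerable.ofNat (List ℕ) m.unpair.1) (l.getD m.unpair.2 default) else
    bif DCDS.eqB r 6 then pvar a m else
    mu a m.unpair.1 (l.getD m.unpair.2 default)
  have hg : Primrec fun p : α × List σ => g p.1 p.2 := by
    refine cond (by fun_prop) (hquery.comp (g := fun p : α × List σ =>
      (p.1, Denumerable.ofNat FO (p.2.length / 8))) (by fun_prop)) ?_
    refine cond (by fun_prop) (hneg.comp (g := fun p : α × List σ =>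
      (p.1, p.2.getD (p.2.length / 8) default)) (by fun_prop)) ?_
    refine cond (by fun_prop) (hand.comp (g := fun p : α × List σ =>
      (p.1, p.2.getD (p.2.length / 8).unpair.1 default,
        p.2.getD (p.2.length / 8).unpair.2 default)) (by fun_prop)) ?_
    refine cond (by fun_prop) (hex.comp (g := fun p : α × List σ =>
      (p.1, (p.2.length / 8).unpair.1, p.2.getD (p.2.length / 8).unpair.2 default))
      (by fun_prop)) ?_
    refine cond (by fun_prop) (hdia.comp (g := fun p : α × List σ =>
      (p.1, Denumerable.ofNat (List ℕ) (p.2.length / 8).unpair.1,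
        p.2.getD (p.2.length / 8).unpair.2 default)) (by fun_prop)) ?_
    refine cond (by fun_prop) (hbox.comp (g := fun p : α × List σ =>
      (p.1, Denumerable.ofNat (List ℕ) (p.2.length / 8).unpair.1,
        p.2.getD (p.2.length / 8).unpair.2 default)) (by fun_prop)) ?_
    refine cond (by fun_prop) (hpvar.comp (g := fun p : α × List σ =>
      (p.1, p.2.length / 8)) (by fun_prop)) ?_
    exact hmu.comp (g := fun p : α × List σ =>
      (p.1, (p.2.length / 8).unpair.1, p.2.getD (p.2.length / 8).unpair.2 default)) (by fun_prop)
  have key := Primrec.nat_strong_rec (fun a n => F a (Denumerable.ofNat MuLP n))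
    (g := fun a l => Option.some (g a l)) (some hg) fun a n => ?_
  · exact (key.comp Primrec.fst (encode Primrec.snd) : Primrec fun p : α × MuLP => _).of_eq fun p => by simp
  congr 1
  change _ = F a (MuLP.ofNat n)
  rw [MuLP.ofNat]
  -- Code `0`, separated in `MuLP.ofNat` because `0 / 8` is not smaller, is a local query and
  -- involves no recursive result.
  split_ifs with h
  · subst h
    simp [g, e0, DCDS.eqB]
  · have hm : n / 8 < n := Nat.div_lt_self (Nat.pos_of_ne_zero h) (by decide)
    have h1 : (n / 8).unpair.1 < n := lt_of_le_of_lt (n / 8).unpair_left_le hm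
    have h2 : (n / 8).unpair.2 < n := lt_of_le_of_lt (n / 8).unpair_right_le hm
    have hget : ∀ k < n, ((List.range n).map fun n =>
        F a (Denumerable.ofNat MuLP n)).getD k default = F a (MuLP.ofNat k) := fun k hk => by
      simp only [List.getD_eq_getElem?_getD, List.getElem?_map, List.getElem?_range hk]
      rfl
    have hl : n % 8 < 8 := Nat.mod_lt _ (by decide)
    simp only [g, List.length_map, List.length_range, hget _ hm, hget _ h1, hget _ h2]
    generalize n % 8 = k at *
    interval_cases k <;> simp [DCDS.eqB, *]

end Presentation

end PrimrecFun

end DCDS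

namespace DCDS

/-! ### The algorithm -/

/-- The valuation given by a list. -/
def valuation (l : List ℕ) (x : ℕ) : ℕ := l.getD x 0

/-- The value of a term under the valuation given by a list. -/
def Term.listVal (l : List ℕ) (t : Term) : ℕ :=
  Sum.elim (fun x => valuation l x) (fun c => c) (Term.equiv t)

/-- The variables of a term. -/
def Term.varList (t : Term) : List ℕ := Sum.elim (fun x => [x]) (fun _ => []) (Term.equiv t)

/-- The ground term that a term denotes under the valuation given by a list. -/
def ETerm.listGround (l : List ℕ) (t : ETerm) : GTerm :=
  Sum.elim (fun t => Sum.inl (t.listVal l)) (fun p => Sum.inr (p.1, p.2.map (Term.listVal l)))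
    (ETerm.equiv t)

namespace FO

/-- The valuations among `W` that satisfy a formula. -/
def sat (W : List (List ℕ)) (D : List ℕ) (I : List Fact) : FO → List (List ℕ)
  | tru => W
  | atom R ts => W.filter fun l => memB (R, ts.map (Term.listVal l)) I
  | eq t u => W.filter fun l => eqB (t.listVal l) (u.listVal l)
  | neg φ => W.filter fun l => !memB l (φ.sat W D I)
  | and φ ψ => W.filter fun l => memB l (φ.sat W D I) && memB l (ψ.sat W D I)
  | or φ ψ => W.filter fun l => memB l (φ.sat W D I) || memB l (ψ.sat W D I)
  | ex x φ => W.filter fun l => D.any fun d => memB (l.set x d) (φ.sat W D I)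

/-- The free variables. -/
def fvList : FO → List ℕ
  | tru => []
  | atom _ ts => ts.flatMap Term.varList
  | eq t u => t.varList ++ u.varList
  | neg φ => φ.fvList
  | and φ ψ => φ.fvList ++ ψ.fvList
  | or φ ψ => φ.fvList ++ ψ.fvList
  | ex x φ => φ.fvList.filter fun y => !eqB x y

/-- The answers to a query among the valuations `W`. -/
def answers (W : List (List ℕ)) (D : List ℕ) (I : List Fact) (Q : FO) : List (List ℕ) :=
  (Q.sat W D I).filter fun l => Q.fvList.all fun x => memB (valuation l x) D

end FO

namespace System

/-- The values below `N` that belong to the evaluation domain over `I`. -/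
def domList (S : System) (N : ℕ) (I : List Fact) : List ℕ :=
  (List.range N).filter fun c => (I ++ S.init).any fun F => memB c F.2

/-- Decision of the equality constraints. -/
def satisfiesB (S : System) (W : List (List ℕ)) (D : List ℕ) (I : List Fact) : Bool :=
  S.constraints.all fun c => (c.query.answers W D I).all fun l =>
    c.eqs.all fun e => eqB (e.1.listVal l) (e.2.listVal l)

/-- The facts over values and service calls that an action produces. -/
def doList (W : List (List ℕ)) (D : List ℕ) (I : List Fact) (α : Action) (σ : List ℕ) :
    List (ℕ × List GTerm) :=
  α.effects.flatMap fun e =>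
    (((FO.and e.qpos e.qneg).answers W D I).filter fun l =>
      α.params.all fun p => eqB (valuation l p) (valuation σ p)).flatMap fun l =>
        e.facts.map fun F => (F.1, F.2.map (ETerm.listGround l))

/-- The value of a ground term, where the service calls `cs` have the results `t`. -/
def groundValue (cs : List Call) (t : List ℕ) (u : GTerm) : ℕ :=
  Sum.elim (fun c => c) (fun c => t.getD (index c cs) 0) u

/-- Replacing the service calls `cs` in a fact by their results `t`. -/
def applyList (cs : List Call) (t : List ℕ) (G : ℕ × List GTerm) : Fact :=
  (G.1, G.2.map (groundValue cs t))

/-- The successors of `I` that result from service call results below `N`. -/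
def successors (S : System) (N : ℕ) (W : List (List ℕ)) (I : List Fact) : List (List Fact) :=
  S.rules.flatMap fun r => (S.actions[r.2]?).toList.flatMap fun α =>
    (r.1.answers W (S.domList N I) I).flatMap fun σ =>
      ((lists (callList S.services (S.domList N I)).length (List.range N)).map fun t =>
        (doList W (S.domList N I) I α σ).map
          (applyList (callList S.services (S.domList N I)) t)).filter fun J =>
            S.satisfiesB W (S.domList N J) J

/-- Whether two lists consist of the same facts. -/
def sameFacts (I J : List Fact) : Bool := (I.all fun F => memB F J) && J.all fun F => memB F I

/-- Whether the instances `L` are those of a finite abstraction with values below `N`. -/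
def isAbstraction (S : System) (N : ℕ) (W : List (List ℕ)) (L : List (List Fact)) : Bool :=
  ltB 0 N && (L.all fun I =>
    (I.all fun F => F.2.all fun c => ltB c N) &&
    ltB ((S.domList N I).length + (callList S.services (S.domList N I)).length) (N + 1) &&
    (S.successors N W I).all fun J => L.any fun I' => sameFacts J I')

/-- An instance with its evaluation domain, its active domain and the indices of its successors. -/
abbrev StateInfo := List Fact × List ℕ × List ℕ × List ℕ

/-- The explicit description of a finite abstraction. -/
def stateInfos (S : System) (N : ℕ) (W : List (List ℕ)) (L : List (List Fact)) :
    List StateInfo :=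
  L.map fun I => (I, S.domList N I, I.flatMap fun F => F.2,
    (List.range L.length).filter fun j =>
      (S.successors N W I).any fun J => sameFacts J (L.getD j []))

end System

namespace MuLP

open DCDS.System (StateInfo)

/-- A valuation of the individual variables, a valuation of the predicate variables by
characteristic functions, and the index of a state. -/
abbrev Config := List ℕ × List (List Bool) × ℕ

/-- The characteristic functions of sets of states. -/
def stateSets (A : List StateInfo) : List (List Bool) := lists A.length [false, true]

/-- All configurations. -/
def configs (M : ℕ) (W : List (List ℕ)) (A : List StateInfo) : List Config :=
  W.flatMap fun v => (lists M (stateSets A)).flatMap fun V =>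
    (List.range A.length).map fun s => (v, V, s)

/-- The configurations that satisfy a formula. -/
def sat (M : ℕ) (W : List (List ℕ)) (A : List StateInfo) : MuLP → List Config
  | query Q => (configs M W A).filter fun p =>
      memB p.1 (Q.sat W (A.getD p.2.2 ([], [], [], [])).2.1 (A.getD p.2.2 ([], [], [], [])).1)
  | neg Φ => (configs M W A).filter fun p => !memB p (Φ.sat M W A)
  | and Φ Ψ => (configs M W A).filter fun p => memB p (Φ.sat M W A) && memB p (Ψ.sat M W A)
  | ex x Φ => (configs M W A).filter fun p =>
      (A.getD p.2.2 ([], [], [], [])).2.2.1.any fun d =>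
        memB (p.1.set x d, p.2.1, p.2.2) (Φ.sat M W A)
  | dia xs Φ => (configs M W A).filter fun p =>
      (A.getD p.2.2 ([], [], [], [])).2.2.2.any fun s =>
        (xs.all fun x => memB (valuation p.1 x) (A.getD s ([], [], [], [])).2.2.1) &&
          memB (p.1, p.2.1, s) (Φ.sat M W A)
  | box xs Φ => (configs M W A).filter fun p =>
      (A.getD p.2.2 ([], [], [], [])).2.2.2.all fun s =>
        (xs.all fun x => memB (valuation p.1 x) (A.getD s ([], [], [], [])).2.2.1) &&
          memB (p.1, p.2.1, s) (Φ.sat M W A)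
  | pvar Z => (configs M W A).filter fun p => (p.2.1.getD Z []).getD p.2.2 false
  | mu Z Φ => (configs M W A).filter fun p => (stateSets A).all fun X =>
      (!(List.range A.length).all fun s =>
        !memB (p.1, p.2.1.set Z X, s) (Φ.sat M W A) || X.getD s false) || X.getD p.2.2 false

/-- Whether the initial state, which has index `0`, satisfies a closed formula. -/
def holdsInitially (M : ℕ) (W : List (List ℕ)) (A : List StateInfo) (Φ : MuLP) : Bool :=
  memB ((List.range M).map fun _ => 0,
    (List.range M).map fun _ => (List.range A.length).map fun _ => false, 0) (Φ.sat M W A)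

end MuLP

/-- The number of variables that the verification has to take into account. -/
def varBound (p : System × MuLP) : ℕ := 6 * Encodable.encode p.1 + Encodable.encode p.2 + 5

/-- All valuations of the variables by values below `N`. -/
def valuations (p : System × MuLP) (N : ℕ) : List (List ℕ) := lists (varBound p) (List.range N)

/-- The result of the verification, if `N` and `L` (without the initial instance) describe a finite
abstraction of the system. -/
def verifyWith (p : System × MuLP) (w : ℕ × List (List Fact)) : Option Bool :=
  bif p.1.isAbstraction w.1 (valuations p w.1) (p.1.init :: w.2) then
    some (p.2.holdsInitially (varBound p) (valuations p w.1)
      (p.1.stateInfos w.1 (valuations p w.1) (p.1.init :: w.2)))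
  else none

/-- The verification procedure: search for a finite abstraction. -/
def verify (p : System × MuLP) : Part Bool :=
  Nat.rfindOpt fun n => (Encodable.decode n : Option (ℕ × List (List Fact))).bind (verifyWith p)

/-! ### The algorithm is effective -/

namespace PrimrecFun

variable {α : Type*} [Primcodable α]

@[fun_prop] theorem valuation {f : α → List ℕ} {g : α → ℕ} (hf : Primrec f) (hg : Primrec g) :
    Primrec fun a => valuation (f a) (g a) := by
  unfold DCDS.valuation
  fun_prop

@[fun_prop] theorem termListVal {f : α → List ℕ} {g : α → Term} (hf : Primrec f)
    (hg : Primrec g) : Primrec fun a => Term.listVal (f a) (g a) := by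
  unfold Term.listVal
  fun_prop

@[fun_prop] theorem termVarList {g : α → Term} (hg : Primrec g) :
    Primrec fun a => Term.varList (g a) := by
  unfold Term.varList
  fun_prop

@[fun_prop] theorem etermListGround {f : α → List ℕ} {g : α → ETerm} (hf : Primrec f)
    (hg : Primrec g) : Primrec fun a => ETerm.listGround (f a) (g a) := by
  unfold ETerm.listGround
  fun_prop

@[fun_prop] theorem foSat {W : α → List (List ℕ)} {D : α → List ℕ} {I : α → List Fact}
    {φ : α → FO} (hW : Primrec W) (hD : Primrec D) (hI : Primrec I) (hφ : Primrec φ) :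
    Primrec fun a => FO.sat (W a) (D a) (I a) (φ a) := by
  refine (foRec (F := fun (a : List (List ℕ) × List ℕ × List Fact) φ =>
      FO.sat a.1 a.2.1 a.2.2 φ)
      (atom := fun a R ts => a.1.filter fun l => DCDS.memB (R, ts.map (Term.listVal l)) a.2.2)
      (eq := fun a t u => a.1.filter fun l => DCDS.eqB (t.listVal l) (u.listVal l))
      (neg := fun a A => a.1.filter fun l => !DCDS.memB l A)
      (and := fun a A B => a.1.filter fun l => DCDS.memB l A && DCDS.memB l B)
      (or := fun a A B => a.1.filter fun l => DCDS.memB l A || DCDS.memB l B)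
      (ex := fun a x A => a.1.filter fun l => a.2.1.any fun d => DCDS.memB (l.set x d) A)
      ?_ ?_ ?_ ?_ ?_ ?_ ?_ (fun _ => rfl) (fun _ _ _ => rfl)
      (fun _ _ _ => rfl) (fun _ _ => rfl) (fun _ _ _ => rfl) (fun _ _ _ => rfl)
      (fun _ _ _ => rfl)).comp
    (g := fun a => ((W a, D a, I a), φ a)) (by fun_prop) <;> (try simp only [FO.sat]) <;> fun_prop

@[fun_prop] theorem foFvList {φ : α → FO} (hφ : Primrec φ) : Primrec fun a => (φ a).fvList := by
  refine (foRec (F := fun (_ : Unit) φ => FO.fvList φ)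
      (neg := fun _ l => l) (and := fun _ l m => l ++ m) (or := fun _ l m => l ++ m)
      (ex := fun _ x l => l.filter fun y => !DCDS.eqB x y) ?_ ?_ ?_ ?_ ?_ ?_ ?_ (fun _ => rfl)
      (fun _ _ _ => rfl) (fun _ _ _ => rfl) (fun _ _ => rfl) (fun _ _ _ => rfl)
      (fun _ _ _ => rfl) (fun _ _ _ => rfl)).comp
    (g := fun a => ((), φ a)) (by fun_prop) <;> (try simp only [FO.fvList]) <;> fun_prop

@[fun_prop] theorem foAnswers {W : α → List (List ℕ)} {D : α → List ℕ} {I : α → List Fact}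
    {φ : α → FO} (hW : Primrec W) (hD : Primrec D) (hI : Primrec I) (hφ : Primrec φ) :
    Primrec fun a => FO.answers (W a) (D a) (I a) (φ a) := by
  unfold FO.answers
  fun_prop

@[fun_prop] theorem callList {f g : α → List ℕ} (hf : Primrec f) (hg : Primrec g) :
    Primrec fun a => callList (f a) (g a) := by
  unfold DCDS.callList
  fun_prop

@[fun_prop] theorem domList {S : α → System} {N : α → ℕ} {I : α → List Fact} (hS : Primrec S)
    (hN : Primrec N) (hI : Primrec I) : Primrec fun a => (S a).domList (N a) (I a) := by
  unfold System.domList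
  fun_prop

@[fun_prop] theorem satisfiesB {S : α → System} {W : α → List (List ℕ)} {D : α → List ℕ}
    {I : α → List Fact} (hS : Primrec S) (hW : Primrec W) (hD : Primrec D) (hI : Primrec I) :
    Primrec fun a => (S a).satisfiesB (W a) (D a) (I a) := by
  unfold System.satisfiesB
  fun_prop

@[fun_prop] theorem doList {W : α → List (List ℕ)} {D : α → List ℕ} {I : α → List Fact}
    {A : α → Action} {σ : α → List ℕ} (hW : Primrec W) (hD : Primrec D) (hI : Primrec I)
    (hA : Primrec A) (hσ : Primrec σ) :
    Primrec fun a => System.doList (W a) (D a) (I a) (A a) (σ a) := by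
  unfold System.doList
  fun_prop

@[fun_prop] theorem groundValue {cs : α → List Call} {t : α → List ℕ} {u : α → GTerm}
    (hcs : Primrec cs) (ht : Primrec t) (hu : Primrec u) :
    Primrec fun a => System.groundValue (cs a) (t a) (u a) := by
  unfold System.groundValue
  fun_prop

@[fun_prop] theorem applyList {cs : α → List Call} {t : α → List ℕ} {G : α → ℕ × List GTerm}
    (hcs : Primrec cs) (ht : Primrec t) (hG : Primrec G) :
    Primrec fun a => System.applyList (cs a) (t a) (G a) := by
  unfold System.applyList
  fun_prop

@[fun_prop] theorem successors {S : α → System} {N : α → ℕ} {W : α → List (List ℕ)}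
    {I : α → List Fact} (hS : Primrec S) (hN : Primrec N) (hW : Primrec W) (hI : Primrec I) :
    Primrec fun a => (S a).successors (N a) (W a) (I a) := by
  unfold System.successors
  fun_prop

@[fun_prop] theorem sameFacts {I J : α → List Fact} (hI : Primrec I) (hJ : Primrec J) :
    Primrec fun a => System.sameFacts (I a) (J a) := by
  unfold System.sameFacts
  fun_prop

@[fun_prop] theorem isAbstraction {S : α → System} {N : α → ℕ} {W : α → List (List ℕ)}
    {L : α → List (List Fact)} (hS : Primrec S) (hN : Primrec N) (hW : Primrec W)
    (hL : Primrec L) : Primrec fun a => (S a).isAbstraction (N a) (W a) (L a) := by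
  unfold System.isAbstraction
  fun_prop

@[fun_prop] theorem stateInfos {S : α → System} {N : α → ℕ} {W : α → List (List ℕ)}
    {L : α → List (List Fact)} (hS : Primrec S) (hN : Primrec N) (hW : Primrec W)
    (hL : Primrec L) : Primrec fun a => (S a).stateInfos (N a) (W a) (L a) := by
  unfold System.stateInfos
  fun_prop

@[fun_prop] theorem stateSets {A : α → List System.StateInfo} (hA : Primrec A) :
    Primrec fun a => MuLP.stateSets (A a) := by
  unfold MuLP.stateSets
  fun_prop

@[fun_prop] theorem configs {M : α → ℕ} {W : α → List (List ℕ)} {A : α → List System.StateInfo}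
    (hM : Primrec M) (hW : Primrec W) (hA : Primrec A) :
    Primrec fun a => MuLP.configs (M a) (W a) (A a) := by
  unfold MuLP.configs
  fun_prop

@[fun_prop] theorem muSat {M : α → ℕ} {W : α → List (List ℕ)} {A : α → List System.StateInfo}
    {Φ : α → MuLP} (hM : Primrec M) (hW : Primrec W) (hA : Primrec A) (hΦ : Primrec Φ) :
    Primrec fun a => (Φ a).sat (M a) (W a) (A a) := by
  refine (muRec (F := fun (a : ℕ × List (List ℕ) × List System.StateInfo) Φ =>
      MuLP.sat a.1 a.2.1 a.2.2 Φ)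
      (neg := fun a B => (MuLP.configs a.1 a.2.1 a.2.2).filter fun p => !DCDS.memB p B)
      (and := fun a B C => (MuLP.configs a.1 a.2.1 a.2.2).filter fun p => DCDS.memB p B && DCDS.memB p C)
      (ex := fun a x B => (MuLP.configs a.1 a.2.1 a.2.2).filter fun p =>
        (a.2.2.getD p.2.2 ([], [], [], [])).2.2.1.any fun d =>
          DCDS.memB (p.1.set x d, p.2.1, p.2.2) B)
      (dia := fun a xs B => (MuLP.configs a.1 a.2.1 a.2.2).filter fun p =>
        (a.2.2.getD p.2.2 ([], [], [], [])).2.2.2.any fun s =>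
          (xs.all fun x => DCDS.memB (DCDS.valuation p.1 x) (a.2.2.getD s ([], [], [], [])).2.2.1) &&
            DCDS.memB (p.1, p.2.1, s) B)
      (box := fun a xs B => (MuLP.configs a.1 a.2.1 a.2.2).filter fun p =>
        (a.2.2.getD p.2.2 ([], [], [], [])).2.2.2.all fun s =>
          (xs.all fun x => DCDS.memB (DCDS.valuation p.1 x) (a.2.2.getD s ([], [], [], [])).2.2.1) &&
            DCDS.memB (p.1, p.2.1, s) B)
      (mu := fun a Z B => (MuLP.configs a.1 a.2.1 a.2.2).filter fun p =>
        (MuLP.stateSets a.2.2).all fun X =>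
          (!(List.range a.2.2.length).all fun s =>
            !DCDS.memB (p.1, p.2.1.set Z X, s) B || X.getD s false) || X.getD p.2.2 false)
      ?_ ?_ ?_ ?_ ?_ ?_ ?_ ?_ (fun _ _ => rfl) (fun _ _ => rfl)
      (fun _ _ _ => rfl) (fun _ _ _ => rfl) (fun _ _ _ => rfl) (fun _ _ _ => rfl)
      (fun _ _ => rfl) (fun _ _ _ => rfl)).comp
    (g := fun a => ((M a, W a, A a), Φ a)) (by fun_prop) <;> (try simp only [MuLP.sat]) <;> fun_prop

@[fun_prop] theorem holdsInitially {M : α → ℕ} {W : α → List (List ℕ)}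
    {A : α → List System.StateInfo} {Φ : α → MuLP} (hM : Primrec M) (hW : Primrec W)
    (hA : Primrec A) (hΦ : Primrec Φ) :
    Primrec fun a => (Φ a).holdsInitially (M a) (W a) (A a) := by
  unfold MuLP.holdsInitially
  fun_prop

@[fun_prop] theorem verifyWith {p : α → System × MuLP} {w : α → ℕ × List (List Fact)}
    (hp : Primrec p) (hw : Primrec w) : Primrec fun a => verifyWith (p a) (w a) := by
  unfold DCDS.verifyWith valuations varBound
  fun_prop

end PrimrecFun

/-- Testing one candidate is primitive recursive; only the search over candidates is unbounded. -/
theorem partrec_verify : Partrec verify :=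
  Partrec.rfindOpt (show Computable₂ fun (p : System × MuLP) (n : ℕ) =>
    (Encodable.decode n : Option (ℕ × List (List Fact))).bind (verifyWith p) from
    Primrec.to_comp (show Primrec fun q : (System × MuLP) × ℕ =>
      (Encodable.decode q.2 : Option (ℕ × List (List Fact))).bind (verifyWith q.1) by fun_prop))

end DCDS

namespace DCDS

open Function

/-! ### Correctness of the query evaluation -/

theorem Term.listVal_eq (l : List ℕ) (t : Term) : t.listVal l = t.val (valuation l) := by
  cases t <;> rfl

theorem Term.mem_varList {x : ℕ} {t : Term} : x ∈ t.varList ↔ x ∈ t.vars := by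
  cases t <;> simp [varList, vars, Term.equiv]

theorem ETerm.listGround_eq (l : List ℕ) (t : ETerm) :
    t.listGround l = t.ground (valuation l) := by
  cases t with
  | plain t => exact congrArg Sum.inl (t.listVal_eq l)
  | call f ts =>
    exact congrArg (fun a => Sum.inr (f, a)) (List.map_congr_left fun t _ => t.listVal_eq l)

theorem valuation_set {l : List ℕ} {x : ℕ} (hx : x < l.length) (d : ℕ) :
    valuation (l.set x d) = update (valuation l) x d := by
  funext y
  by_cases h : y = x
  · subst h
    simp [valuation, hx]
  · simp [valuation, h, List.getElem?_set_ne (Ne.symm h)]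

theorem encode_le_of_mem {α : Type*} [Encodable α] {a : α} : ∀ {l : List α}, a ∈ l →
    Encodable.encode a ≤ Encodable.encode l
  | b :: l, h => by
    rw [Encodable.encode_list_cons]
    rcases List.mem_cons.1 h with rfl | h
    · exact (Nat.left_le_pair _ _).trans (Nat.le_succ _)
    · exact (encode_le_of_mem h).trans ((Nat.right_le_pair _ _).trans (Nat.le_succ _))

theorem Term.le_encode_of_mem_vars {x : ℕ} {t : Term} (hx : x ∈ t.vars) :
    x ≤ Encodable.encode t := by
  cases t with
  | var y =>
    obtain rfl : x = y := by simpa [vars] using hx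
    change x ≤ Encodable.encode (Sum.inl x : ℕ ⊕ ℕ)
    simp
    omega
  | const c => simp [vars] at hx

namespace FO

theorem mem_fvList {φ : FO} : ∀ {x : ℕ}, x ∈ φ.fvList ↔ x ∈ φ.fv := by
  induction φ with
  | tru => simp [fvList, fv]
  | atom R ts => simp [fvList, fv, Term.mem_varList]
  | eq t u => simp [fvList, fv, Term.mem_varList]
  | neg φ ih => exact ih
  | and φ ψ ih1 ih2 => simp [fvList, fv, ih1, ih2]
  | or φ ψ ih1 ih2 => simp [fvList, fv, ih1, ih2]
  | ex y φ ih =>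
    intro x
    simp only [fvList, fv, List.mem_filter, ih, Bool.not_eq_true', Bool.eq_false_iff, ne_eq,
      eqB_iff, Finset.mem_erase]
    rw [and_comm, eq_comm]

/-- This lets the code of a formula bound the length of the lists that represent valuations. -/
theorem le_toNat_of_mem_fv {φ : FO} : ∀ {x : ℕ}, x ∈ φ.fv → x ≤ φ.toNat := by
  induction φ with
  | tru => simp [fv]
  | atom R ts =>
    intro x hx
    obtain ⟨t, ht, hx⟩ := Finset.mem_biUnion.1 hx
    have h1 := (Term.le_encode_of_mem_vars hx).trans (encode_le_of_mem (List.mem_toFinset.1 ht))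
    have h2 := Nat.right_le_pair R (Encodable.encode ts)
    rw [toNat]
    omega
  | eq t u =>
    intro x hx
    have h1 := Nat.left_le_pair (Encodable.encode t) (Encodable.encode u)
    have h2 := Nat.right_le_pair (Encodable.encode t) (Encodable.encode u)
    rw [toNat]
    rcases Finset.mem_union.1 hx with hx | hx <;> have := Term.le_encode_of_mem_vars hx <;> omega
  | neg φ ih =>
    intro x hx
    have := ih hx
    rw [toNat]
    omega
  | and φ ψ ih1 ih2 | or φ ψ ih1 ih2 =>
    intro x hx
    have h1 := Nat.left_le_pair φ.toNat ψ.toNat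
    have h2 := Nat.right_le_pair φ.toNat ψ.toNat
    rw [toNat]
    rcases Finset.mem_union.1 hx with hx | hx
    · have := ih1 hx
      omega
    · have := ih2 hx
      omega
  | ex y φ ih =>
    intro x hx
    have h1 := ih (Finset.mem_of_mem_erase hx)
    have h2 := Nat.right_le_pair y φ.toNat
    rw [toNat]
    omega

theorem _root_.DCDS.Term.val_congr {v w : ℕ → ℕ} {t : Term} (h : ∀ x ∈ t.vars, v x = w x) :
    t.val v = t.val w := by
  cases t with
  | var x => exact h x (by simp [Term.vars])
  | const c => rfl

theorem holds_congr {D : Finset ℕ} {I : Inst} {φ : FO} : ∀ {v w : ℕ → ℕ},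
    (∀ x ∈ φ.fv, v x = w x) → (Holds D I v φ ↔ Holds D I w φ) := by
  induction φ with
  | tru => intros; rfl
  | atom R ts =>
    intro v w h
    have : ts.map (Term.val v) = ts.map (Term.val w) := List.map_congr_left fun t ht =>
      Term.val_congr fun x hx => h x (Finset.mem_biUnion.2 ⟨t, by simpa using ht, hx⟩)
    simp only [Holds, this]
  | eq t u =>
    intro v w h
    simp only [Holds]
    rw [Term.val_congr fun x hx => h x (Finset.mem_union_left _ hx),
      Term.val_congr fun x hx => h x (Finset.mem_union_right _ hx)]
  | neg φ ih => intro v w h; exact not_congr (ih h)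
  | and φ ψ ih1 ih2 =>
    intro v w h
    exact and_congr (ih1 fun x hx => h x (Finset.mem_union_left _ hx))
      (ih2 fun x hx => h x (Finset.mem_union_right _ hx))
  | or φ ψ ih1 ih2 =>
    intro v w h
    exact or_congr (ih1 fun x hx => h x (Finset.mem_union_left _ hx))
      (ih2 fun x hx => h x (Finset.mem_union_right _ hx))
  | ex x φ ih =>
    intro v w h
    refine exists_congr fun d => and_congr_right fun _ => ih fun y hy => ?_
    by_cases hyx : y = x
    · simp [hyx]
    · simpa [hyx] using h y (Finset.mem_erase.2 ⟨hyx, hy⟩)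

theorem isAnswer_congr {D : Finset ℕ} {I : Inst} {φ : FO} {v w : ℕ → ℕ}
    (h : ∀ x ∈ φ.fv, v x = w x) : φ.IsAnswer D I v ↔ φ.IsAnswer D I w :=
  and_congr (forall₂_congr fun x hx => by rw [h x hx]) (holds_congr h)

variable {M N : ℕ} {D : List ℕ} {I : List Fact} {l : List ℕ}

theorem set_mem_lists {α : Type*} {n : ℕ} {A : List α} {w : List α} (hw : w ∈ lists n A) {a : α}
    (ha : a ∈ A) (x : ℕ) : w.set x a ∈ lists n A := by
  rw [mem_lists] at *
  refine ⟨by simpa using hw.1, fun b hb => ?_⟩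
  rcases List.mem_or_eq_of_mem_set hb with hb | rfl
  · exact hw.2 b hb
  · exact ha

/-- As `M` exceeds the code, every quantified variable is a position in the lists of length `M`, so
`List.set` really updates the valuation; as `D` lies below `N`, the updated list is again among
those enumerated. -/
theorem mem_sat (hD : ∀ d ∈ D, d < N) {φ : FO} (hφ : φ.toNat < M) :
    ∀ {l}, l ∈ φ.sat (lists M (List.range N)) D I ↔
      l ∈ lists M (List.range N) ∧ φ.Holds D.toFinset I.toFinset (valuation l) := by
  induction φ with
  | tru => simp [sat, Holds]
  | atom R ts => simp [sat, Holds, funext (Term.listVal_eq _)]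
  | eq t u => simp [sat, Holds, Term.listVal_eq]
  | neg φ ih =>
    rw [toNat] at hφ
    intro l
    simp only [sat, List.mem_filter, Bool.not_eq_true', Bool.eq_false_iff, ne_eq, memB_iff,
      ih (by omega), Holds]
    tauto
  | and φ ψ ih1 ih2 =>
    have h1 := Nat.left_le_pair φ.toNat ψ.toNat
    have h2 := Nat.right_le_pair φ.toNat ψ.toNat
    rw [toNat] at hφ
    intro l
    simp only [sat, List.mem_filter, Bool.and_eq_true, memB_iff, ih1 (by omega), ih2 (by omega),
      Holds]
    tauto
  | or φ ψ ih1 ih2 =>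
    have h1 := Nat.left_le_pair φ.toNat ψ.toNat
    have h2 := Nat.right_le_pair φ.toNat ψ.toNat
    rw [toNat] at hφ
    intro l
    simp only [sat, List.mem_filter, Bool.or_eq_true, memB_iff, ih1 (by omega), ih2 (by omega),
      Holds]
    tauto
  | ex x φ ih =>
    have h1 := Nat.left_le_pair x φ.toNat
    have h2 := Nat.right_le_pair x φ.toNat
    rw [toNat] at hφ
    intro l
    simp only [sat, List.mem_filter, List.any_eq_true, memB_iff, ih (by omega), Holds,
      List.mem_toFinset]
    refine and_congr_right fun hl => exists_congr fun d => and_congr_right fun hd => ?_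
    rw [valuation_set (by rw [(mem_lists.1 hl).1]; omega)]
    exact and_iff_right (set_mem_lists hl (List.mem_range.2 (hD d hd)) x)

theorem mem_answers (hD : ∀ d ∈ D, d < N) {Q : FO} (hQ : Q.toNat < M) :
    l ∈ Q.answers (lists M (List.range N)) D I ↔
      l ∈ lists M (List.range N) ∧ Q.IsAnswer D.toFinset I.toFinset (valuation l) := by
  simp only [answers, List.mem_filter, mem_sat hD hQ, List.all_eq_true, memB_iff, mem_fvList,
    IsAnswer, List.mem_toFinset]
  tauto

end FO

/-- The list of the first `M` values of a valuation, with `0` in place of values that are not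
below `N`. -/
def restrict (M N : ℕ) (v : ℕ → ℕ) : List ℕ :=
  (List.range M).map fun x => if v x < N then v x else 0

theorem restrict_mem {M N : ℕ} (hN : 0 < N) (v : ℕ → ℕ) :
    restrict M N v ∈ lists M (List.range N) := by
  simp only [mem_lists, restrict, List.length_map, List.length_range, List.mem_map,
    List.mem_range, true_and]
  rintro _ ⟨x, -, rfl⟩
  split_ifs with h
  · exact h
  -- The default entry `0` must itself be a value below `N`; this is why positivity of `N` is part
  -- of the test.
  · exact hN

theorem valuation_restrict {M N : ℕ} {v : ℕ → ℕ} {x : ℕ} (hx : x < M) (hv : v x < N) :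
    valuation (restrict M N v) x = v x := by
  simp [valuation, restrict, hx, hv]

/-! ### Correctness of the successors -/

namespace System

/-- All variables of the queries of the system are below `M`. -/
structure VarsBelow (S : System) (M : ℕ) : Prop where
  constraints : ∀ c ∈ S.constraints, c.query.toNat < M
  effects : ∀ α ∈ S.actions, ∀ e ∈ α.effects, (FO.and e.qpos e.qneg).toNat < M
  rules : ∀ r ∈ S.rules, r.1.toNat < M

/-- The largest codes come from the conjunctions of `qpos` and `qneg`, which are formed anew: their
code is `6 * Nat.pair _ _ + 4`, with the pair at most the code of the system. Hence the coefficients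
`6` and `5` in `varBound`. -/
theorem varsBelow (p : System × MuLP) : p.1.VarsBelow (varBound p) := by
  obtain ⟨S, Φ⟩ := p
  have hS : Encodable.encode S = Encodable.encode (System.equiv S) := rfl
  simp only [System.equiv, Equiv.coe_fn_mk, Encodable.encode_prod_val] at hS
  change S.VarsBelow (6 * Encodable.encode S + Encodable.encode Φ + 5)
  have l1 := fun a b => Nat.left_le_pair a b
  have l2 := fun a b => Nat.right_le_pair a b
  have a1 : Encodable.encode S.constraints ≤ Encodable.encode S := by
    rw [hS]; exact (l1 _ _).trans (l2 _ _)
  have a2 : Encodable.encode S.actions ≤ Encodable.encode S := by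
    rw [hS]
    exact (l1 _ _).trans <| (l2 _ _).trans <| (l2 _ _).trans <| (l2 _ _).trans (l2 _ _)
  have a3 : Encodable.encode S.rules ≤ Encodable.encode S := by
    rw [hS]
    exact (l2 _ _).trans <| (l2 _ _).trans <| (l2 _ _).trans <| (l2 _ _).trans (l2 _ _)
  refine ⟨fun c hc => ?_, fun α hα e he => ?_, fun r hr => ?_⟩
  · have h1 : c.query.toNat ≤ Encodable.encode c :=
      l1 (Encodable.encode c.query) (Encodable.encode c.eqs)
    have h2 := encode_le_of_mem hc
    omega
  · have h1 : Nat.pair e.qpos.toNat e.qneg.toNat ≤ Encodable.encode e := by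
      change _ ≤ Nat.pair e.qpos.toNat (Nat.pair e.qneg.toNat (Encodable.encode e.facts))
      rcases (l1 e.qneg.toNat (Encodable.encode e.facts)).eq_or_lt with h | h
      · exact (congrArg (Nat.pair e.qpos.toNat) h).le
      · exact (Nat.pair_lt_pair_right _ h).le
    have h2 : Encodable.encode α.effects ≤ Encodable.encode α :=
      l2 (Encodable.encode α.params) _
    have h3 := encode_le_of_mem hα
    have h4 := encode_le_of_mem he
    rw [FO.toNat]
    omega
  · have h1 : r.1.toNat ≤ Encodable.encode r := by
      obtain ⟨Q, k⟩ := r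
      exact l1 _ _
    have h2 := encode_le_of_mem hr
    omega

variable {S : System} {M N : ℕ} {I J : List Fact} {K : Inst}

/-- The values in a list of facts are below `N`. -/
def ValuesBelow (N : ℕ) (I : List Fact) : Prop := ∀ F ∈ I, ∀ c ∈ F.2, c < N

theorem valuesBelow_iff : ValuesBelow N I ↔ adom I.toFinset ⊆ Finset.range N := by
  constructor
  · intro h c hc
    obtain ⟨F, hF, hc⟩ := mem_adom.1 hc
    exact Finset.mem_range.2 (h F (List.mem_toFinset.1 hF) c hc)
  · exact fun h F hF c hc => Finset.mem_range.1 (h (mem_adom.2 ⟨F, List.mem_toFinset.2 hF, hc⟩))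

theorem domList_lt : ∀ d ∈ S.domList N I, d < N := by
  simp only [domList, List.mem_filter, List.mem_range]
  exact fun d hd => hd.1

theorem toFinset_domList (hS : ValuesBelow N S.init) (hI : ValuesBelow N I) :
    (S.domList N I).toFinset = S.dom I.toFinset := by
  ext c
  simp only [domList, List.toFinset_filter, List.any_eq_true, List.mem_append, memB_iff,
    Finset.mem_filter, List.mem_toFinset, List.mem_range, dom, Finset.mem_union, mem_adom, I₀]
  constructor
  · rintro ⟨-, F, hF | hF, hc⟩
    · exact .inl ⟨F, hF, hc⟩
    · exact .inr ⟨F, hF, hc⟩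
  · rintro (⟨F, hF, hc⟩ | ⟨F, hF, hc⟩)
    · exact ⟨hI F hF c hc, F, .inl hF, hc⟩
    · exact ⟨hS F hF c hc, F, .inr hF, hc⟩

theorem mem_domList (hS : ValuesBelow N S.init) (hI : ValuesBelow N I) {c : ℕ} :
    c ∈ S.domList N I ↔ c ∈ S.dom I.toFinset := by
  rw [← toFinset_domList hS hI, List.mem_toFinset]

theorem dom_lt (hS : ValuesBelow N S.init) (hI : ValuesBelow N I) {c : ℕ}
    (hc : c ∈ S.dom I.toFinset) : c < N := domList_lt c ((mem_domList hS hI).2 hc)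

theorem length_domList (hS : ValuesBelow N S.init) (hI : ValuesBelow N I) :
    (S.domList N I).length = (S.dom I.toFinset).card := by
  rw [← toFinset_domList hS hI, List.toFinset_card_of_nodup]
  exact List.nodup_range.filter _

/-- Arbitrary valuations reduce to enumerated ones: an answer has its free variables in the
evaluation domain, hence below `N`, so `restrict` does not change it there, and the equalities
mention only those variables. -/
theorem satisfiesB_iff (hW : S.WellFormed) (hM : S.VarsBelow M) (hN : 0 < N)
    (hS : ValuesBelow N S.init) (hI : ValuesBelow N I) :
    S.satisfiesB (lists M (List.range N)) (S.domList N I) I = true ↔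
      S.Satisfies I.toFinset := by
  simp only [satisfiesB, List.all_eq_true, eqB_iff, Term.listVal_eq, Satisfies]
  refine forall₂_congr fun c hc => ?_
  simp only [FO.mem_answers domList_lt (hM.constraints c hc), toFinset_domList hS hI]
  refine ⟨fun h v hv e he => ?_, fun h l hl e he => h _ hl.2 e he⟩
  have hr : ∀ x ∈ c.query.fv, valuation (restrict M N v) x = v x := fun x hx =>
    valuation_restrict ((FO.le_toNat_of_mem_fv hx).trans_lt (hM.constraints c hc))
      (dom_lt hS hI (hv.1 x hx))
  have := h _ ⟨restrict_mem hN v, (FO.isAnswer_congr hr).2 hv⟩ e he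
  have hE := ((hW.constraints c hc).2 e he).2
  rwa [Term.val_congr fun x hx => hr x (hE (Finset.mem_union_left _ hx)),
    Term.val_congr fun x hx => hr x (hE (Finset.mem_union_right _ hx))] at this

theorem ground_congr {v w : ℕ → ℕ} {services : List ℕ} {A X : Finset ℕ} {t : ETerm}
    (ht : t.Over services A X) (h : ∀ x ∈ X, v x = w x) : t.ground v = t.ground w := by
  cases t with
  | plain t => exact congrArg Sum.inl (Term.val_congr fun x hx => h x (ht.2 hx))
  | call f ts =>
    exact congrArg (fun a => Sum.inr (f, a))
      (List.map_congr_left fun t h' => Term.val_congr fun x hx => h x ((ht.2 t h').2 hx))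

theorem doFacts_congr {α : Action} {σ τ : ℕ → ℕ} (h : ∀ p ∈ α.params, σ p = τ p) :
    S.doFacts K α σ = S.doFacts K α τ := by
  ext G
  refine exists_congr fun e => and_congr_right fun _ => exists_congr fun v =>
    and_congr_left fun _ => forall₂_congr fun p hp => by rw [h p hp]

theorem mem_doList (hW : S.WellFormed) (hM : S.VarsBelow M) (hN : 0 < N)
    (hS : ValuesBelow N S.init) (hI : ValuesBelow N I) {r : FO × ℕ} (hr : r ∈ S.rules)
    {α : Action} (hα : S.actions[r.2]? = some α) {σ : List ℕ}
    (hσ : r.1.IsAnswer (S.dom I.toFinset) I.toFinset (valuation σ)) {G : ℕ × List GTerm} :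
    G ∈ doList (lists M (List.range N)) (S.domList N I) I α σ ↔
      G ∈ S.doFacts I.toFinset α (valuation σ) := by
  have hα' := List.mem_of_getElem? hα
  obtain ⟨α', hα'', hfv⟩ := (hW.rules r hr).2
  obtain rfl : α = α' := by simpa [hα] using hα''
  have hground : ∀ l, ETerm.listGround l = ETerm.ground (valuation l) := fun l =>
    funext (ETerm.listGround_eq l)
  simp only [doList, List.mem_flatMap, List.mem_filter, List.all_eq_true, eqB_iff, List.mem_map,
    doFacts, Set.mem_ofPred_eq, hground]
  refine exists_congr fun e => and_congr_right fun he => ?_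
  simp only [FO.mem_answers domList_lt (hM.effects α hα' e he), toFinset_domList hS hI]
  constructor
  · rintro ⟨l, ⟨⟨-, hl⟩, hp⟩, F, hF, rfl⟩
    exact ⟨valuation l, hp, hl, F, hF, rfl⟩
  · rintro ⟨v, hp, hv, F, hF, rfl⟩
    obtain ⟨-, -, -, -, hE⟩ := hW.effects α hα' e he
    have h1 : ∀ x ∈ (FO.and e.qpos e.qneg).fv, valuation (restrict M N v) x = v x :=
      fun x hx => valuation_restrict
        ((FO.le_toNat_of_mem_fv hx).trans_lt (hM.effects α hα' e he)) (dom_lt hS hI (hv.1 x hx))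
    -- Parameters need not occur in the effect query; their values are below `N` because they are
    -- free variables of the answered rule query.
    have h2 : ∀ x ∈ α.params, valuation (restrict M N v) x = v x := fun x hx => by
      have hx' : x ∈ r.1.fv := by rw [hfv]; simpa using hx
      refine valuation_restrict ((FO.le_toNat_of_mem_fv hx').trans_lt (hM.rules r hr)) ?_
      rw [hp x hx]
      exact dom_lt hS hI (hσ.1 x hx')
    refine ⟨restrict M N v, ⟨⟨restrict_mem hN v, (FO.isAnswer_congr h1).2 hv⟩, fun p hp' => ?_⟩,
      F, hF, ?_⟩
    · rw [h2 p hp', hp p hp']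
    · simp only [Prod.mk.injEq, true_and]
      refine List.map_congr_left fun t ht => ground_congr ((hE F hF).2 t ht) fun x hx => ?_
      rcases Finset.mem_union.1 hx with hx | hx
      · exact h1 x (Finset.mem_union_left _ hx)
      · exact h2 x (List.mem_toFinset.1 hx)

/-- The service call results given by a list. -/
def callResult (cs : List Call) (t : List ℕ) (c : Call) : ℕ := t.getD (index c cs) 0

theorem applyList_eq (cs : List Call) (t : List ℕ) (G : ℕ × List GTerm) :
    applyList cs t G = applyEval (callResult cs t) G := by
  refine congrArg (Prod.mk G.1) (List.map_congr_left fun u _ => ?_)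
  cases u <;> rfl

theorem mem_calls (hW : S.WellFormed) (hS : ValuesBelow N S.init) (hI : ValuesBelow N I)
    {r : FO × ℕ} (hr : r ∈ S.rules) {α : Action} (hα : S.actions[r.2]? = some α) {σ : ℕ → ℕ}
    (hσ : r.1.IsAnswer (S.dom I.toFinset) I.toFinset σ) {G : ℕ × List GTerm}
    (hG : G ∈ S.doFacts I.toFinset α σ) {u : GTerm} (hu : u ∈ G.2) :
    (∃ c < N, u = .inl c) ∨ ∃ c ∈ callList S.services (S.domList N I), u = .inr c := by
  rcases (mem_doFacts_cases hW hr hα hσ hG).2 u hu with ⟨c, hc, rfl⟩ | ⟨c, rfl, hc⟩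
  · exact .inl ⟨c, dom_lt hS hI hc, rfl⟩
  · refine .inr ⟨c, ?_, rfl⟩
    simpa only [mem_callList, mem_domList hS hI] using hc

theorem callResult_lt {cs : List Call} {t : List ℕ} (ht : t ∈ lists cs.length (List.range N))
    {c : Call} (hc : c ∈ cs) : callResult cs t c < N := by
  rw [mem_lists] at ht
  have h : index c cs < t.length := by
    rw [ht.1]
    exact index_lt hc
  rw [callResult, List.getD_eq_getElem _ _ h]
  exact List.mem_range.1 (ht.2 _ (List.getElem_mem h))

theorem exec_of_mem_successors (hW : S.WellFormed) (hM : S.VarsBelow M) (hN : 0 < N)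
    (hS : ValuesBelow N S.init) (hI : ValuesBelow N I)
    (hJ : J ∈ S.successors N (lists M (List.range N)) I) :
    S.Exec I.toFinset J.toFinset ∧ ValuesBelow N J := by
  simp only [successors, List.mem_flatMap, List.mem_filter, List.mem_map,
    Option.mem_toList] at hJ
  obtain ⟨r, hr, α, hα, σ, hσ, ⟨t, ht, rfl⟩, hs⟩ := hJ
  rw [FO.mem_answers domList_lt (hM.rules r hr), toFinset_domList hS hI] at hσ
  have hdo := fun G => mem_doList hW hM hN hS hI hr hα hσ.2 (G := G)
  have hb : ValuesBelow N ((doList (lists M (List.range N)) (S.domList N I) I α σ).map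
      (applyList (callList S.services (S.domList N I)) t)) := by
    intro F hF c hc
    obtain ⟨G, hG, rfl⟩ := List.mem_map.1 hF
    rw [applyList_eq] at hc
    obtain ⟨u, hu, rfl⟩ := List.mem_map.1 hc
    rcases mem_calls hW hS hI hr hα hσ.2 ((hdo G).1 hG) hu with ⟨c, hc', rfl⟩ | ⟨c, hc', rfl⟩
    · exact hc'
    · exact callResult_lt ht hc'
  refine ⟨⟨r, hr, α, hα, valuation σ, hσ.2, callResult (callList S.services (S.domList N I)) t,
    ?_, (satisfiesB_iff hW hM hN hS hb).1 hs⟩, hb⟩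
  ext F
  simp [applyList_eq, hdo]

/-- Of the function `θ` only its values at the finitely many calls in `callList` matter, and a call
occurring in a produced fact has its result in `K`, hence below `N`. So a table of results below `N`
reproduces `K`. -/
theorem exists_mem_successors (hW : S.WellFormed) (hM : S.VarsBelow M) (hN : 0 < N)
    (hS : ValuesBelow N S.init) (hI : ValuesBelow N I) (hE : S.Exec I.toFinset K)
    (hK : adom K ⊆ Finset.range N) :
    ∃ J ∈ S.successors N (lists M (List.range N)) I, J.toFinset = K := by
  obtain ⟨r, hr, α, hα, σ, hσ, θ, hθ, hs⟩ := hE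
  have hr' : ∀ x ∈ r.1.fv, valuation (restrict M N σ) x = σ x := fun x hx =>
    valuation_restrict ((FO.le_toNat_of_mem_fv hx).trans_lt (hM.rules r hr))
      (dom_lt hS hI (hσ.1 x hx))
  have hσ' := (FO.isAnswer_congr hr').2 hσ
  obtain ⟨α', hα', hfv⟩ := (hW.rules r hr).2
  obtain rfl : α = α' := by simpa [hα] using hα'
  have hdo := fun G => mem_doList hW hM hN hS hI hr hα hσ' (G := G)
  rw [doFacts_congr (τ := σ) fun p hp => hr' p (by rw [hfv]; simpa using hp)] at hdo
  set cs := callList S.services (S.domList N I) with hcs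
  -- Entries at or above `N` belong to calls that do not occur in produced facts; replacing them by
  -- `0` keeps the table in the enumerated range.
  let t := cs.map fun c => if θ c < N then θ c else 0
  have ht : t ∈ lists cs.length (List.range N) := by
    rw [mem_lists]
    refine ⟨List.length_map _, fun a ha => ?_⟩
    obtain ⟨c, -, rfl⟩ := List.mem_map.1 ha
    rw [List.mem_range]
    split_ifs with h
    · exact h
    · exact hN
  have hcall : ∀ c ∈ cs, θ c < N → callResult cs t c = θ c := fun c hc h => by
    simp [callResult, t, index_lt hc, getElem_index hc, h]
  have happ : ∀ G ∈ S.doFacts I.toFinset α σ, applyList cs t G = applyEval θ G := by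
    intro G hG
    rw [applyList_eq]
    refine congrArg (Prod.mk G.1) (List.map_congr_left fun u hu => ?_)
    rcases mem_calls hW hS hI hr hα hσ hG hu with ⟨c, -, rfl⟩ | ⟨c, hc, rfl⟩
    · rfl
    · refine hcall c hc (Finset.mem_range.1 (hK (mem_adom.2 ⟨applyEval θ G, ?_, ?_⟩)))
      · rw [← Finset.mem_coe, hθ]
        exact ⟨G, hG, rfl⟩
      · exact List.mem_map.2 ⟨_, hu, rfl⟩
  let J := (doList (lists M (List.range N)) (S.domList N I) I α (restrict M N σ)).map
    (applyList cs t)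
  have hJ : J.toFinset = K := by
    rw [← Finset.coe_inj, hθ]
    ext F
    simp only [J, List.coe_toFinset, List.mem_map, hdo, Set.mem_ofPred_eq, Set.mem_image]
    exact exists_congr fun G => and_congr_right fun hG => by rw [happ G hG]
  have hJb : ValuesBelow N J := valuesBelow_iff.2 (hJ ▸ hK)
  refine ⟨J, ?_, hJ⟩
  simp only [successors, List.mem_flatMap, List.mem_filter, List.mem_map, Option.mem_toList]
  refine ⟨r, hr, α, hα, restrict M N σ, ?_, ⟨t, ht, rfl⟩,
    (satisfiesB_iff hW hM hN hS hJb).2 (hJ.symm ▸ hs)⟩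
  rw [FO.mem_answers domList_lt (hM.rules r hr), toFinset_domList hS hI]
  exact ⟨restrict_mem hN σ, hσ'⟩

theorem sameFacts_iff : sameFacts I J = true ↔ I.toFinset = J.toFinset := by
  simp only [sameFacts, Bool.and_eq_true, List.all_eq_true, memB_iff, Finset.ext_iff,
    List.mem_toFinset]
  exact ⟨fun h F => ⟨h.1 F, h.2 F⟩, fun h => ⟨fun F => (h F).1, fun F => (h F).2⟩⟩

end System

end DCDS

namespace DCDS

open Function

/-! ### Correctness of the model checking -/

namespace MuLP

/-- The finite transition system described by `A`, with initial state `i`. -/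
abbrev infoTS (A : List System.StateInfo) (i : Fin A.length) : TS where
  State := Fin A.length
  init := i
  db s := A[s].1.toFinset
  step s t := t.1 ∈ A[s].2.2.2

/-- The domains and the indices in `A` are as they should be. -/
structure Consistent (N : ℕ) (A : List System.StateInfo) (i : Fin A.length) : Prop where
  dom : ∀ s : Fin A.length, A[s].2.1.toFinset = (infoTS A i).dom s
  adom : ∀ s : Fin A.length, A[s].2.2.1.toFinset = adom A[s].1.toFinset
  dom_lt : ∀ s : Fin A.length, ∀ d ∈ A[s].2.1, d < N
  succ_lt : ∀ s : Fin A.length, ∀ t ∈ A[s].2.2.2, t < A.length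

/-- The valuation of the predicate variables given by characteristic functions. -/
def predValuation {n : ℕ} (V : List (List Bool)) (Z : ℕ) : Set (Fin n) :=
  {s | (V.getD Z []).getD s false = true}

theorem predValuation_set {n : ℕ} {V : List (List Bool)} {Z : ℕ} (hZ : Z < V.length)
    (X : List Bool) : predValuation (n := n) (V.set Z X) =
      update (predValuation V) Z {s | X.getD s false = true} := by
  funext Y
  by_cases h : Y = Z
  · subst h
    simp [predValuation, hZ]
  · simp [predValuation, h, List.getElem?_set_ne (Ne.symm h)]

variable {M N : ℕ} {A : List System.StateInfo} {i : Fin A.length}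

theorem mem_configs {W : List (List ℕ)} {v : List ℕ} {V : List (List Bool)} {s : ℕ} :
    (v, V, s) ∈ configs M W A ↔ v ∈ W ∧ V ∈ lists M (stateSets A) ∧ s < A.length := by
  simp [configs]

theorem exists_stateSet (X : Set (Fin A.length)) :
    ∃ x ∈ stateSets A, X = {s : Fin A.length | x.getD s false = true} := by
  classical
  refine ⟨List.ofFn fun s => decide (s ∈ X), ?_, ?_⟩
  · simp only [stateSets, mem_lists, List.length_ofFn, true_and]
    intro b _
    cases b <;> simp
  · ext s
    simp

/-- Over finitely many states each set is given by a characteristic list (`exists_stateSet`), so the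
intersection of all pre-fixpoints is evaluated literally as a finite conjunction. No iteration, and
hence no monotonicity, is involved. -/
theorem mem_sat (hA : Consistent N A i) {Φ : MuLP} :
    Φ.toNat < M → ∀ {v : List ℕ} {V : List (List Bool)} {s : Fin A.length}, v ∈ lists M (List.range N) →
      V ∈ lists M (stateSets A) → ((v, V, s.1) ∈ Φ.sat M (lists M (List.range N)) A ↔
        s ∈ Φ.sem (infoTS A i) (valuation v) (predValuation V)) := by
  have hget : ∀ s : Fin A.length, A.getD s ([], [], [], []) = A[s] := fun s => by simp
  have hadom : ∀ (s : Fin A.length) (c : ℕ), c ∈ A[s].2.2.1 ↔ c ∈ DCDS.adom A[s].1.toFinset :=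
    fun s c => by rw [← hA.adom, List.mem_toFinset]
  have hlt : ∀ (s : Fin A.length) (c : ℕ), c ∈ DCDS.adom A[s].1.toFinset → c < N := by
    intro s c hc
    refine hA.dom_lt s c (List.mem_toFinset.1 ?_)
    rw [hA.dom]
    exact Finset.mem_union_left _ hc
  induction Φ with
  | query Q =>
    intro hΦ v V s hv hV
    have hQ : Q.toNat < M := by
      change 8 * Q.toNat < M at hΦ
      omega
    simp only [sat, List.mem_filter, mem_configs, hv, hV, s.2, true_and, memB_iff, hget,
      FO.mem_sat (hA.dom_lt s) hQ, hA.dom]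
    rfl
  | neg Φ ih =>
    intro hΦ v V s hv hV
    rw [toNat] at hΦ
    simp only [sat, List.mem_filter, mem_configs, hv, hV, s.2, true_and, Bool.not_eq_true',
      Bool.eq_false_iff, ne_eq, memB_iff, ih (by omega) hv hV]
    rfl
  | and Φ Ψ ih1 ih2 =>
    intro hΦ v V s hv hV
    have h1 := Nat.left_le_pair Φ.toNat Ψ.toNat
    have h2 := Nat.right_le_pair Φ.toNat Ψ.toNat
    rw [toNat] at hΦ
    simp only [sat, List.mem_filter, mem_configs, hv, hV, s.2, true_and, Bool.and_eq_true,
      memB_iff, ih1 (by omega) hv hV, ih2 (by omega) hv hV]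
    rfl
  | ex x Φ ih =>
    intro hΦ v V s hv hV
    have h1 := Nat.left_le_pair x Φ.toNat
    have h2 := Nat.right_le_pair x Φ.toNat
    rw [toNat] at hΦ
    simp only [sat, List.mem_filter, mem_configs, hv, hV, s.2, true_and, List.any_eq_true,
      memB_iff, hget, hadom]
    refine exists_congr fun d => and_congr_right fun hd => ?_
    rw [ih (by omega) (FO.set_mem_lists hv (List.mem_range.2 (hlt s d hd)) x) hV,
      valuation_set (by rw [(mem_lists.1 hv).1]; omega)]
  | dia xs Φ ih =>
    intro hΦ v V s hv hV
    have h2 := Nat.right_le_pair (Encodable.encode xs) Φ.toNat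
    rw [toNat] at hΦ
    simp only [sat, List.mem_filter, mem_configs, hv, hV, s.2, true_and, List.any_eq_true,
      List.all_eq_true, Bool.and_eq_true, memB_iff, hget]
    constructor
    · rintro ⟨t, ht, hl, hs⟩
      have hs' := (ih (s := ⟨t, hA.succ_lt s t ht⟩) (by omega) hv hV).1 hs
      refine ⟨⟨t, hA.succ_lt s t ht⟩, ht, fun x hx => ?_, hs'⟩
      exact (hadom _ _).1 (by rw [← hget]; exact hl x hx)
    · rintro ⟨(t : Fin A.length), ht, hl, hs⟩
      refine ⟨t.1, ht, fun x hx => ?_, (ih (by omega) hv hV).2 hs⟩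
      rw [hget]
      exact (hadom _ _).2 (hl x hx)
  | box xs Φ ih =>
    intro hΦ v V s hv hV
    have h2 := Nat.right_le_pair (Encodable.encode xs) Φ.toNat
    rw [toNat] at hΦ
    simp only [sat, List.mem_filter, mem_configs, hv, hV, s.2, true_and, List.all_eq_true,
      Bool.and_eq_true, memB_iff, hget]
    constructor
    · intro h (t : Fin A.length) ht
      obtain ⟨hl, hs⟩ := h t.1 ht
      refine ⟨fun x hx => (hadom _ _).1 (by rw [← hget]; exact hl x hx),
        (ih (by omega) hv hV).1 hs⟩
    · intro h t ht
      obtain ⟨hl, hs⟩ := h ⟨t, hA.succ_lt s t ht⟩ ht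
      refine ⟨fun x hx => ?_, (ih (s := ⟨t, hA.succ_lt s t ht⟩) (by omega) hv hV).2 hs⟩
      rw [hget ⟨t, hA.succ_lt s t ht⟩]
      exact (hadom _ _).2 (hl x hx)
  | pvar Z =>
    intro hΦ v V s hv hV
    simp only [sat, List.mem_filter, mem_configs, hv, hV, s.2, true_and]
    rfl
  | mu Z Φ ih =>
    intro hΦ v V s hv hV
    have h1 := Nat.left_le_pair Z Φ.toNat
    have h2 := Nat.right_le_pair Z Φ.toNat
    rw [toNat] at hΦ
    have key : ∀ x ∈ stateSets A, ((∀ t < A.length,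
        (v, V.set Z x, t) ∈ Φ.sat M (lists M (List.range N)) A → x.getD t false = true) ↔
        Φ.sem (infoTS A i) (valuation v) (update (predValuation V) Z
          {s : Fin A.length | x.getD s false = true}) ⊆
            {s : Fin A.length | x.getD s false = true}) := by
      intro x hx
      rw [← predValuation_set (by rw [(mem_lists.1 hV).1]; omega)]
      refine ⟨fun h t ht => h t.1 t.2 ?_, fun h t ht hs => ?_⟩
      · exact (ih (by omega) hv (FO.set_mem_lists hV hx Z)).2 ht
      · exact h (a := ⟨t, ht⟩)
          ((ih (s := ⟨t, ht⟩) (by omega) hv (FO.set_mem_lists hV hx Z)).1 hs)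
    simp only [sat, List.mem_filter, mem_configs, hv, hV, s.2, true_and, List.all_eq_true,
      Bool.or_eq_true, Bool.not_eq_true', Bool.eq_false_iff, ne_eq, List.mem_range, memB_iff,
      ← imp_iff_not_or]
    constructor
    · intro h X hX
      obtain ⟨x, hx, rfl⟩ := exists_stateSet X
      exact h x hx ((key x hx).2 hX)
    · intro h x hx hX
      exact h {s : Fin A.length | x.getD s false = true} ((key x hx).1 hX)

/-- Positions outside a list default to `0` and to the empty set, so the constant lists represent
exactly the valuations used in `TS.Models`. -/
theorem holdsInitially_iff (hA : Consistent N A i) (hi : i.1 = 0) (hN : 0 < N) {Φ : MuLP}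
    (hΦ : Φ.toNat < M) :
    Φ.holdsInitially M (lists M (List.range N)) A = true ↔ (infoTS A i).Models Φ := by
  have h1 : valuation ((List.range M).map fun _ => 0) = fun _ => 0 := by
    funext x
    by_cases hx : x < M <;> simp [valuation, hx]
  have h2 : predValuation ((List.range M).map fun _ => (List.range A.length).map fun _ => false) =
      fun _ => (∅ : Set (Fin A.length)) := by
    funext Z
    ext s
    by_cases hZ : Z < M <;> simp [predValuation, hZ]
  have h3 := mem_sat hA hΦ (s := i) (v := (List.range M).map fun _ => 0)
    (V := (List.range M).map fun _ => (List.range A.length).map fun _ => false) ?_ ?_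
  · rw [hi, h1, h2] at h3
    rw [holdsInitially, memB_iff]
    exact h3
  · simp only [mem_lists, List.length_map, List.length_range, List.mem_map, true_and]
    rintro _ ⟨_, -, rfl⟩
    exact List.mem_range.2 hN
  · simp only [mem_lists, List.length_map, List.length_range, List.mem_map, true_and, stateSets]
    rintro _ ⟨_, -, rfl⟩
    simp

end MuLP

/-! ### Correctness of the verification -/

namespace System

variable {S : System} {M N : ℕ} {L : List (List Fact)}

theorem isAbstraction_iff {W : List (List ℕ)} : S.isAbstraction N W L = true ↔ 0 < N ∧
    ∀ I ∈ L, ValuesBelow N I ∧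
      (S.domList N I).length + callBound S.services (S.domList N I).length ≤ N ∧
      ∀ J ∈ S.successors N W I, ∃ I' ∈ L, J.toFinset = I'.toFinset := by
  simp only [isAbstraction, Bool.and_eq_true, List.all_eq_true, List.any_eq_true, ltB_iff,
    sameFacts_iff, length_callList, Nat.lt_succ_iff, and_assoc, ValuesBelow]

theorem adom_toFinset (I : List Fact) :
    (I.flatMap fun F => F.2).toFinset = adom I.toFinset := by
  ext c
  simp [mem_adom]

/-- The abstraction that has been found is equivalent to the concrete transition system. -/
theorem stateInfos_correct (hW : S.WellFormed) (hM : S.VarsBelow M)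
    (hL : S.isAbstraction N (lists M (List.range N)) (S.init :: L) = true) :
    ∃ i : Fin (S.stateInfos N (lists M (List.range N)) (S.init :: L)).length, i.1 = 0 ∧
      MuLP.Consistent N _ i ∧ (MuLP.infoTS _ i).db i = S.I₀ ∧
      PersistenceBisimilar (MuLP.infoTS _ i) S.concrete := by
  obtain ⟨hN, hL⟩ := isAbstraction_iff.1 hL
  have hS : ValuesBelow N S.init := (hL S.init (by simp)).1
  set L' := S.init :: L with hL'
  set A := S.stateInfos N (lists M (List.range N)) L' with hA
  have hlen : A.length = L'.length := by simp [hA, stateInfos]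
  have hI : ∀ s : Fin A.length, L'[s.1]'(hlen ▸ s.2) ∈ L' := fun s => List.getElem_mem _
  have hget : ∀ s : Fin A.length, A[s] = (L'[s.1]'(hlen ▸ s.2),
      S.domList N (L'[s.1]'(hlen ▸ s.2)), (L'[s.1]'(hlen ▸ s.2)).flatMap fun F => F.2,
      (List.range L'.length).filter fun j =>
        (S.successors N (lists M (List.range N)) (L'[s.1]'(hlen ▸ s.2))).any fun J =>
          sameFacts J (L'.getD j [])) := fun s => by
    simp [hA, stateInfos]
  let i : Fin A.length := ⟨0, by simp [hlen, hL']⟩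
  have hdb : ∀ s : Fin A.length, (MuLP.infoTS A i).db s = (L'[s.1]'(hlen ▸ s.2)).toFinset := fun s =>
    congrArg (fun a => a.1.toFinset) (hget s)
  have hdbi : (MuLP.infoTS A i).db i = S.I₀ := hdb i
  have hstep : ∀ s t : Fin A.length, (MuLP.infoTS A i).step s t ↔
      S.Exec ((MuLP.infoTS A i).db s) ((MuLP.infoTS A i).db t) := by
    intro s t
    have ht : t.1 < L'.length := hlen ▸ t.2
    change t.1 ∈ A[s].2.2.2 ↔ _
    rw [hget, hdb, hdb]
    simp only [List.mem_filter, List.mem_range, ht, true_and, List.any_eq_true, sameFacts_iff,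
      List.getD_eq_getElem _ _ ht]
    constructor
    · rintro ⟨J, hJ, e⟩
      rw [← e]
      exact (exec_of_mem_successors hW hM hN hS (hL _ (hI s)).1 hJ).1
    · exact fun h => exists_mem_successors hW hM hN hS (hL _ (hI s)).1 h
        (valuesBelow_iff.1 (hL _ (hI t)).1)
  refine ⟨i, rfl, ⟨fun s => ?_, fun s => ?_, fun s d hd => ?_, fun s t ht => ?_⟩, hdbi,
    persistenceBisimilar_concrete hW (N := N) hdbi hstep (fun s => ?_) (fun s => ?_)
      fun s K hE hK => ?_⟩
  · have : (MuLP.infoTS A i).dom s = S.dom (L'[s.1]'(hlen ▸ s.2)).toFinset := by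
      rw [← hdb, System.dom, ← hdbi]
      rfl
    rw [this, hget]
    exact toFinset_domList hS (hL _ (hI s)).1
  · rw [hget]
    exact adom_toFinset _
  · rw [hget] at hd
    exact domList_lt d hd
  · rw [hget] at ht
    simpa [hlen] using (List.mem_filter.1 ht).1
  · rw [hdb]
    exact fun c hc => Finset.mem_range.2 (dom_lt hS (hL _ (hI s)).1 hc)
  · rw [hdb, ← length_domList hS (hL _ (hI s)).1]
    exact (hL _ (hI s)).2.1
  · rw [hdb] at hE
    -- An execution into the pool appears among the computed successors, and the closure test
    -- supplies a listed instance with the same facts. Reachability of the listed instances plays no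
    -- role.
    obtain ⟨J, hJ, rfl⟩ := exists_mem_successors hW hM hN hS (hL _ (hI s)).1 hE hK
    obtain ⟨I', hI', e⟩ := (hL _ (hI s)).2.2 J hJ
    obtain ⟨t, ht, rfl⟩ := List.getElem_of_mem hI'
    exact ⟨⟨t, hlen.symm ▸ ht⟩, (hdb _).trans e.symm⟩

/-- The witness lists all reachable instances over a sufficient pool: these satisfy the counting
inequality by state-boundedness and are closed under successors below `N`. -/
theorem exists_abstraction (hW : S.WellFormed) (hb : S.StateBounded) (hM : S.VarsBelow M) :
    ∃ (N : ℕ) (L : List (List Fact)),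
      S.isAbstraction N (lists M (List.range N)) (S.init :: L) = true := by
  obtain ⟨N₀, h₀, hN₀⟩ := hb.exists_pool
  -- The increment makes `N` positive, as the test demands.
  let N := N₀ + 1
  have h₁ : adom S.I₀ ⊆ Finset.range N :=
    h₀.trans (Finset.range_subset_range.2 (Nat.le_succ N₀))
  have hS : ValuesBelow N S.init := valuesBelow_iff.2 h₁
  let L := (finite_reachable_below hW N).toFinset.toList.map Finset.toList
  have hL : ∀ I ∈ S.init :: L, S.Reachable I.toFinset ∧ ValuesBelow N I := by
    intro I hI
    rcases List.mem_cons.1 hI with rfl | hI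
    · exact ⟨Relation.ReflTransGen.refl, hS⟩
    · obtain ⟨K, hK, rfl⟩ := List.mem_map.1 hI
      simp only [Finset.mem_toList, Set.Finite.mem_toFinset, Set.mem_ofPred_eq] at hK
      rw [valuesBelow_iff, Finset.toList_toFinset]
      exact hK
  refine ⟨N, L, isAbstraction_iff.2 ⟨Nat.succ_pos _, fun I hI => ⟨(hL I hI).2, ?_, ?_⟩⟩⟩
  · rw [length_domList hS (hL I hI).2]
    exact (hN₀ _ (hL I hI).1).trans (Nat.le_succ _)
  · intro J hJ
    obtain ⟨hE, hJb⟩ := exec_of_mem_successors hW hM (Nat.succ_pos _) hS (hL I hI).2 hJ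
    refine ⟨J.toFinset.toList, List.mem_cons_of_mem _ (List.mem_map_of_mem ?_), by simp⟩
    simp only [Finset.mem_toList, Set.Finite.mem_toFinset, Set.mem_ofPred_eq]
    exact ⟨(hL I hI).1.tail hE, valuesBelow_iff.1 hJb⟩

end System

/-- Soundness rests on the test alone: whatever passes it is bisimilar to the concrete system. -/
theorem verifyWith_eq_some {p : System × MuLP} {w : ℕ × List (List Fact)} {b : Bool}
    (hW : p.1.WellFormed) (hΦ : p.2.IsProperty p.1) (h : verifyWith p w = some b) :
    b = true ↔ p.1.concrete.Models p.2 := by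
  rw [verifyWith] at h
  cases hL : p.1.isAbstraction w.1 (valuations p w.1) (p.1.init :: w.2) with
  | false => simp [hL] at h
  | true =>
    obtain ⟨i, hi, hA, hdb, hbis⟩ := System.stateInfos_correct hW (System.varsBelow p) hL
    have hN := (System.isAbstraction_iff.1 hL).1
    have hM : p.2.toNat < varBound p := by
      change p.2.toNat < 6 * Encodable.encode p.1 + p.2.toNat + 5
      omega
    rw [hL, cond_true, Option.some.injEq] at h
    rw [← h, valuations, MuLP.holdsInitially_iff hA hi hN hM]
    exact System.models_iff_of_bisimilar hdb hbis hΦ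

theorem verify_correct {p : System × MuLP} (hW : p.1.WellFormed) (hb : p.1.StateBounded)
    (hΦ : p.2.IsProperty p.1) :
    ∃ b : Bool, b ∈ verify p ∧ (b = true ↔ p.1.concrete.Models p.2) := by
  have hdom : (verify p).Dom := by
    rw [verify, Nat.rfindOpt_dom]
    obtain ⟨N, L, hL⟩ := System.exists_abstraction hW hb (System.varsBelow p)
    refine ⟨Encodable.encode (N, L), p.2.holdsInitially (varBound p) (valuations p N)
      (p.1.stateInfos N (valuations p N) (p.1.init :: L)), ?_⟩
    rw [Encodable.encodek, Option.bind_some, verifyWith, valuations, hL, cond_true]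
    exact rfl
  refine ⟨(verify p).get hdom, Part.get_mem hdom, ?_⟩
  -- The search may stop at a candidate other than the one that proves termination; any accepted
  -- candidate gives the right answer.
  obtain ⟨n, hn⟩ := Nat.rfindOpt_spec (Part.get_mem hdom)
  obtain ⟨w, -, hw⟩ := Option.bind_eq_some_iff.1 hn
  exact verifyWith_eq_some hW hΦ hw

end DCDS

/-- Verification of closed persistence-preserving mu-calculus properties of state-bounded DCDSs with
nondeterministic services is decidable, uniformly in the system and the property and without a bound
being given; moreover the concrete transition system of every such DCDS has a finite-state
subsystem that is persistence-preserving bisimilar to it and satisfies the same properties. -/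
theorem mainTheorem1 :
    (∃ decide : DCDS.System × DCDS.MuLP →. Bool, Partrec decide ∧
      ∀ (S : DCDS.System) (Φ : DCDS.MuLP), S.WellFormed → S.StateBounded → Φ.IsProperty S →
        ∃ b : Bool, b ∈ decide (S, Φ) ∧ (b = true ↔ S.concrete.Models Φ)) ∧
    (∀ S : DCDS.System, S.WellFormed → S.StateBounded →
      ∃ (P : Set S.concrete.State) (E : S.concrete.State → S.concrete.State → Prop)
        (h : S.concrete.init ∈ P), P.Finite ∧ (∀ s t, E s t → S.concrete.step s t) ∧
        DCDS.PersistenceBisimilar (S.concrete.sub P E h) S.concrete ∧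
        ∀ Φ : DCDS.MuLP, Φ.IsProperty S →
          ((S.concrete.sub P E h).Models Φ ↔ S.concrete.Models Φ)) :=
  ⟨⟨DCDS.verify, DCDS.partrec_verify, fun _ _ hW hb hΦ => DCDS.verify_correct hW hb hΦ⟩,
    fun _ hW hb => DCDS.System.exists_finite_abstraction hW hb⟩
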